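/- **Fast-growing functions.** $F_1(m)=2m$, $F_{d+1}(m)=F_d^{(m)}(1)$; $\mathfrak F_0$ is the set of polynomial functions with coefficients in $\mathbb N$, and $\mathfrak F_{d+1}=\{F_{d+1}\circ r_1\circ\dots\circ r_k \mid k\ge 0,\ r_1,\dots,r_k\in\mathfrak F_d\}$. **Asymptotic overapproximation.** For finite $B,F\subseteq\mathbb N^n$ let $\mathbb N(F)$ (resp. $\mathbb N_{\ge1}(F)$) be the set of sums $\sum_{f\in F}\lambda_f f$ with all $\lambda_f\ge 0$ (resp. all $\lambda_f\geq 1$). A set $L=B+\mathbb N(F)$ is called hybridlinear (linear if $|B|=1$). For $X\subseteq L$ write $X\trianglelefteq_g L$ if for all $x\in L$, $w\in\mathbb N_{\ge1}(F)$ there is $N\le g(\mathrm{size}(X)+\mathrm{size}(x)+\mathrm{size}(w))$ with $x+mw\in X$ for all $m\ge N$. Here $\mathrm{size}(X)$ is the size of a representation of $X$, vectors are written in binary, and relations $R\subseteq\mathbb N^{m}\times\mathbb N^{n}$ are viewed as subsets of $\mathbb N^{m+n}$. $R$ is monotone if $m=n$ and $(x,y)\in R$ implies $(x+a,y+a)\in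 R$ for all $a\in\mathbb N^n$. For $z=(z_s,z_t)\in\mathbb N^n\times\mathbb N^n$ put $\Delta(z)=z_t-z_s$. **The class.** Let $\alpha\ge2$ and let $\mathcal C$ be a class of relations $R\subseteq\mathbb N^m\times\mathbb N^n$ (represented by binary words) such that (a) $\mathcal C$ is approximable in $\mathfrak F_\alpha$: for some $g\in\mathfrak F_\alpha$ there is an algorithm with running time in $\mathfrak F_\alpha$ that, given $R\in\mathcal C$, outputs finitely many $R_j\in\mathcal C$ and hybridlinear $L_j=B_j+\mathbb N(F_j)$ with $R=\bigcup_j R_j$ and $R_j\trianglelefteq_g L_j$ for all $j$, all $R_j$ being monotone if $R$ is; (b) an algorithm with running time in $\mathfrak F_\alpha$ computes a representation of $R\cap S\in\mathcal C$ from $R\in\mathcal C$ and a semilinear $S$. **m-eVASS.** A monotone $\mathcal C$-eVASS $(\mathcal V,q_{in},q_{fin})$ whose graph of strongly connected components (SCCs) is a line consists of finite strongly connected directed multigraphs $\mathcal V_i=(Q_i,E_i)$, $1\le i\le r$, $r\ge1$ (trivial if $E_i=\emptyset$), with $n_i$ counters and states $q_{in,i},q_{fin,i}\in Q_i$, where $q_{in}=q_{in,1}$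 and $q_{fin}=q_{fin,r}$, and of one bridge edge $e_i$ from $q_{fin,i}$ to $q_{in,i+1}$ for each $1\le i<r$. Every $e\in E_i$ is labelled with a monotone relation $R(e)\in\mathcal C$ on $\mathbb N^{n_i}$. A bridge $e_i$ is labelled with a relation $R(e_i)\subseteq\mathbb N^{n_i}\times\mathbb N^{n_{i+1}}$ in $\mathcal C$, or adds counters with value $0$, or deletes counters that have value $0$; in the last two cases $R(e_i)$ denotes the corresponding relation. An edge $e$ from $q$ to $q'$ allows the steps $q(x)\to q'(y)$ with $(x,y)\in R(e)$, and $\mathrm{Rel}(\mathcal V_i,p,q)$ is the set of source/target pairs of the runs inside $\mathcal V_i$ from $p$ to $q$. The dimension of $\mathcal V$ is the maximum over all $i$ and $q\in Q_i$ of the dimension of the $\mathbb Q$-vector space generated by $\Delta(\mathrm{Rel}(\mathcal V_i,q,q))$. Every edge $e$ comes with a linear set $L(e)=b(e)+\mathbb N(F(e))$; it is part of the representation of $\mathcal V$, whose size is $\mathrm{size}(\mathcal V)$. **Characteristic system.** Its variables, over $\mathbb N$, are the vectors $x_i,y_i$ of length $n_i$ (source and target of $\mathcal V_i$), $\#(e)$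 for $e\in E_i$, and $\#(e,p)$ for every edge or bridge $e$ and period $p\in F(e)$. Its equations are: for all $i$ and $q\in Q_i$, the sum of $\#(e)$ over the edges $e\in E_i$ entering $q$ minus the sum over those leaving $q$ equals $\mathbb 1_{q=q_{fin,i}}-\mathbb 1_{q=q_{in,i}}$; for all $i$, $y_i-x_i=\sum_{e\in E_i}\big(\#(e)\Delta(b(e))+\sum_{p\in F(e)}\#(e,p)\Delta(p)\big)$; for all $i<r$, $(y_i,x_{i+1})=b(e_i)+\sum_{p\in F(e_i)}\#(e_i,p)\,p$. Let $\mathrm{sol}$ be the set of solutions in $\mathbb N$. A variable is unbounded if solutions assign arbitrarily large values to it. **Perfectness.** Let $g_0\in\mathfrak F_\alpha$. $\mathcal V$ is perfect (with respect to $g_0$) if (1) $b(e)\in R(e)\trianglelefteq_{g_0}L(e)$ for every edge and bridge $e$; (2) all edge variables and all period variables (of bridges and of edges inside SCCs) are unbounded; (3) on every bounded source or target variable all solutions agree; (4) for every non-trivial $\mathcal V_i$ and counter $j$ with $x_{i,j}$ and $y_{i,j}$ bounded, $\mathcal V_i$ has a cycle with non-zero effect on $j$; (5) for every non-trivial $\mathcal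 V_i$ and every configuration $p(x)$ of $\mathcal V_i$ there are $(a,b)\in\mathrm{Rel}(\mathcal V_i,q_{in,i},p)$ with $b\ge x$ and $a$ the value of $x_i$ in some solution, and $(a',b')\in\mathrm{Rel}(\mathcal V_i,p,q_{fin,i})$ with $a'\ge x$ and $b'$ the value of $y_i$ in some solution. **Concretizable solutions.** Let $\rho$ be a run of $\mathcal V$ from $q_{in}$ to $q_{fin}$, every step $(x,y)\in R(e)$ of which comes with numbers $c_p\in\mathbb N$ of uses of the periods $p\in F(e)$ such that $(x,y)=b(e)+\sum_{p}c_p\,p$ if $e$ is a bridge, and $(x,y)=b(e)+\sum_{p}c_p\,p+(a,a)$ for some $a\in\mathbb N^{n_i}$ if $e\in E_i$. It induces the solution $\mathrm{sol}(\rho)$ of the characteristic system in which $x_i,y_i$ are the configurations in which $\rho$ enters and leaves $\mathcal V_i$, $\#(e)$ is the number of uses of $e$, and $\#(e,p)$ is the total number of uses of the period $p$ of $e$. A solution is concretizable if it is of the form $\mathrm{sol}(\rho)$; let $\mathrm{Conc}(\mathcal V,q_{in},q_{fin})$ be the set of these solutions, represented by $\mathcal V$. **Theorem.** For all $\alpha,\mathcal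 C,g_0$ as above and every $d\in\mathbb N$ there is a function $g\in\mathfrak F_{\alpha+2d+2}$ such that for every perfect $\mathcal V$ of dimension at most $d$ the set $\mathrm{sol}$ is hybridlinear and $\mathrm{Conc}(\mathcal V,q_{in},q_{fin})\trianglelefteq_g\mathrm{sol}$, for every presentation $\mathrm{sol}=B+\mathbb N(F)$ with $B$ and $F$ finite. -/

import Mathlib

namespace EVASS

/-! ### The fast-growing hierarchy -/

/-- The fast-growing functions: `F 1 m = 2 * m` and `F (d + 1) m` is the `m`-fold iterate of `F d`
applied to `1`. (The value at index `0` is never used.) -/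
def fastF : ℕ → ℕ → ℕ
  | 0, m => m
  | 1, m => 2 * m
  | d + 2, m => (fastF (d + 1))^[m] 1

/-- The levels `𝔉_d = {F_d ∘ r₁ ∘ ⋯ ∘ r_k | r₁, …, r_k ∈ 𝔉_{d-1}}` of the hierarchy. The recursion
starts with the polynomial functions. -/
def level : ℕ → Set (ℕ → ℕ)
  | 0 => {f | ∃ p : Polynomial ℕ, f = fun x => p.eval x}
  | d + 1 => {f | ∃ rs : List (ℕ → ℕ), (∀ r ∈ rs, r ∈ level d) ∧
      f = fastF (d + 1) ∘ rs.foldr (fun r h => r ∘ h) id}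

/-! ### Vectors, relations, sizes -/

/-- Vectors of `n` natural numbers. -/
abbrev Vec (n : ℕ) := Fin n → ℕ

/-- Elements of `ℕ^m × ℕ^n`, identified with `ℕ^(m+n)`. -/
abbrev Pair (m n : ℕ) := Vec m × Vec n

/-- Size of a vector of natural numbers, written in binary with separators. -/
def vecSize {ι : Type} [Fintype ι] (x : ι → ℕ) : ℕ := ∑ i, (Nat.size (x i) + 1)

/-- Size of a pair of vectors. -/
def pairSize {m n : ℕ} (z : Pair m n) : ℕ := vecSize z.1 + vecSize z.2

/-- The effect `z_t - z_s` of a pair `z = (z_s, z_t)`. -/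
def effect {n : ℕ} (z : Pair n n) : Fin n → ℤ := fun j => (z.2 j : ℤ) - (z.1 j : ℤ)

/-- A relation on `ℕ^m × ℕ^n` is monotone if `m = n` and it is closed under adding the same vector
to source and target. -/
def MonotoneRel {m n : ℕ} (R : Set (Pair m n)) : Prop :=
  ∃ h : n = m, ∀ z ∈ R, ∀ a : Vec m, (z.1 + a, z.2 + fun j => a (Fin.cast h j)) ∈ R

section Hybridlinear

variable {M : Type} [AddCommMonoid M]

/-- The hybridlinear set `B + ℕ(F)`. -/
def hybrid (B F : Finset M) : Set M :=
  {x | ∃ b ∈ B, ∃ c : M → ℕ, x = b + ∑ f ∈ F, c f • f}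

/-- `ℕ_{≥1}(F)`: the sums of all elements of `F`, each with a coefficient at least `1`. -/
def fullCombinations (F : Finset M) : Set M :=
  {w | ∃ c : M → ℕ, (∀ f ∈ F, 1 ≤ c f) ∧ w = ∑ f ∈ F, c f • f}

/-- `B + ℕ(F)` is a `g`-bounded asymptotic overapproximation of `X`, where `sX` is the size of
(the representation of) `X` and `size` measures points. -/
def AsympOverapprox (size : M → ℕ) (g : ℕ → ℕ) (sX : ℕ) (X : Set M) (B F : Finset M) : Prop :=
  X ⊆ hybrid B F ∧
    ∀ x ∈ hybrid B F, ∀ w ∈ fullCombinations F,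
      ∃ N ≤ g (sX + size x + size w), ∀ m : ℕ, N ≤ m → x + m • w ∈ X

end Hybridlinear

/-! ### Encodings as words over a four letter alphabet -/

/-- Binary digits and brackets. -/
inductive Sym
  | zero | one | opening | closing

/-- Put a word in brackets. -/
def bracket (w : List Sym) : List Sym := Sym.opening :: w ++ [Sym.closing]

/-- A binary word. -/
def encBits (w : List Bool) : List Sym :=
  bracket (w.map fun b => if b then Sym.one else Sym.zero)

/-- A natural number in binary. -/
def encNat (a : ℕ) : List Sym := encBits a.bits

/-- A list of encoded objects. -/
def encList {β : Type} (enc : β → List Sym) (l : List β) : List Sym := bracket (l.flatMap enc)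

/-- A vector. -/
def encVec {n : ℕ} (x : Vec n) : List Sym := encList encNat (List.ofFn x)

/-- A pair of vectors. -/
def encPair {m n : ℕ} (z : Pair m n) : List Sym := encVec z.1 ++ encVec z.2

/-- A dimension, in unary. -/
def encDim (n : ℕ) : List Sym := bracket (List.replicate n Sym.one)

/-! ### Classes of relations -/

/-- A class of relations between vectors of natural numbers, given by representations of its members
as binary words: `IsCode m n w` says that `w` represents a member of the class that is a subset of
`ℕ^m × ℕ^n`, and `rel m n w` is this member. -/
structure RelClass where
  IsCode : (m n : ℕ) → List Bool → Prop
  rel : (m n : ℕ) → List Bool → Set (Pair m n)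

namespace RelClass

variable (C : RelClass)

/-- The representations of members of the class that are subsets of `ℕ^m × ℕ^n`. -/
abbrev Code (m n : ℕ) := {w : List Bool // C.IsCode m n w}

variable {C}

/-- The relation represented by a code. -/
def Code.set {m n : ℕ} (R : C.Code m n) : Set (Pair m n) := C.rel m n R.1

/-- The size of a represented relation. -/
def Code.size {m n : ℕ} (R : C.Code m n) : ℕ := R.1.length + m + n

variable (C)

/-- A represented relation of arbitrary dimensions. -/
structure Coded where
  m : ℕ
  n : ℕ
  code : C.Code m n

variable {C}

/-- The encoding of a represented relation as an input word. -/
def Coded.enc (R : C.Coded) : List Sym := encDim R.m ++ encDim R.n ++ encBits R.code.1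

variable (C)

/-- A member of the class together with a description of a hybridlinear set. -/
structure Piece (m n : ℕ) where
  code : C.Code m n
  bases : List (Pair m n)
  periods : List (Pair m n)

variable {C}

/-- The encoding of a piece as an output word. -/
def Piece.enc {m n : ℕ} (P : C.Piece m n) : List Sym :=
  encBits P.code.1 ++ encList encPair P.bases ++ encList encPair P.periods

variable (C)

/-- The class is approximable in `𝔉_α`: there are `g ∈ 𝔉_α` and an algorithm (a multi-stack Turing
machine) with running time in `𝔉_α` that splits every member `R` of the class into finitely many
members, monotone if `R` is, each with a `g`-bounded asymptotic overapproximation. -/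
def Approximable (α : ℕ) : Prop :=
  ∃ g ∈ level α, ∃ out : (R : C.Coded) → List (C.Piece R.m R.n),
    (∃ T : Turing.TM2ComputableInTime (Coded.enc (C := C)) (id : List Sym → List Sym)
        (fun R => encList Piece.enc (out R)), T.time ∈ level α) ∧
    ∀ R : C.Coded,
      R.code.set = {z | ∃ P ∈ out R, z ∈ P.code.set} ∧
      (MonotoneRel R.code.set → ∀ P ∈ out R, MonotoneRel P.code.set) ∧
      ∀ P ∈ out R, AsympOverapprox pairSize g P.code.size P.code.set
        P.bases.toFinset P.periods.toFinset

/-- A description of a semilinear relation: a list of bases, each with a list of periods. -/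
abbrev SemilinearDesc (m n : ℕ) := List (Pair m n × List (Pair m n))

/-- The semilinear relation with a given description. -/
def semilinearSet {m n : ℕ} (S : SemilinearDesc m n) : Set (Pair m n) :=
  {z | ∃ L ∈ S, z ∈ hybrid {L.1} L.2.toFinset}

/-- The encoding of a description of a semilinear relation. -/
def encSemilinear {m n : ℕ} (S : SemilinearDesc m n) : List Sym :=
  encList (fun L => encPair L.1 ++ encList encPair L.2) S

/-- The class is effectively closed under intersection with semilinear relations in `𝔉_α`. -/
def ClosedUnderSemilinearInter (α : ℕ) : Prop :=
  ∃ out : (R : C.Coded) → SemilinearDesc R.m R.n → C.Code R.m R.n,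
    (∃ T : Turing.TM2ComputableInTime
        (fun a : (Σ R : C.Coded, SemilinearDesc R.m R.n) => a.1.enc ++ encSemilinear a.2)
        (id : List Sym → List Sym)
        (fun a => encBits (out a.1 a.2).1), T.time ∈ level α) ∧
    ∀ (R : C.Coded) (S : SemilinearDesc R.m R.n),
      (out R S).set = R.code.set ∩ semilinearSet S

end RelClass

/-! ### Monotone extended VASS whose graph of strongly connected components is a line -/

/-- Labels of an edge between two components with `m` and `n` active counters: a relation of the
class, an addition of counters (the new counters, with value `0`, are those outside the range of the
order embedding), or a deletion of counters (which have to be `0`). -/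
inductive BridgeLabel (C : RelClass) (m n : ℕ)
  | rel (R : C.Code m n)
  | add (i : Fin m ↪o Fin n)
  | del (i : Fin n ↪o Fin m)

/-- `y` is `x` with the coordinates outside the range of `i` added with value `0`. -/
def IsExtension {m n : ℕ} (i : Fin m ↪o Fin n) (x : Vec m) (y : Vec n) : Prop :=
  (∀ j, y (i j) = x j) ∧ ∀ j, j ∉ Set.range i → y j = 0

/-- Semantics of the edges between components. -/
def BridgeLabel.set {C : RelClass} {m n : ℕ} : BridgeLabel C m n → Set (Pair m n)
  | .rel R => R.set
  | .add i => {z | IsExtension i z.1 z.2}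
  | .del i => {z | IsExtension i z.2 z.1}

/-- Size of the labels of edges between components. -/
def BridgeLabel.size {C : RelClass} {m n : ℕ} : BridgeLabel C m n → ℕ
  | .rel R => R.size
  | .add _ => m + n
  | .del _ => m + n

/-- A monotone eVASS over the class `C` with initial and final state, whose SCC graph is a line of
`k + 1` strongly connected components (possibly trivial ones, without edges), together with linear
sets `b(e) + ℕ(F(e))` for all its edges. The initial state is `qin 0`, the final state is
`qfin (Fin.last k)`, and the unique edge from the `i`-th to the next component (the `i`-th bridge)
leads from the state `qfin i.castSucc` to the state `qin i.succ`. -/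
structure MEVASS (C : RelClass) where
  /-- number of bridges -/
  k : ℕ
  /-- number of active counters of a component -/
  n : Fin (k + 1) → ℕ
  /-- number of states of a component -/
  numStates : Fin (k + 1) → ℕ
  /-- number of edges inside a component -/
  numEdges : Fin (k + 1) → ℕ
  src : ∀ i, Fin (numEdges i) → Fin (numStates i)
  tgt : ∀ i, Fin (numEdges i) → Fin (numStates i)
  stronglyConnected : ∀ i (p q : Fin (numStates i)),
    Relation.ReflTransGen (fun p q => ∃ e, src i e = p ∧ tgt i e = q) p q
  /-- labels of the edges inside a component -/
  label : ∀ i, Fin (numEdges i) → C.Code (n i) (n i)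
  monotone : ∀ i e, MonotoneRel (label i e).set
  qin : ∀ i, Fin (numStates i)
  qfin : ∀ i, Fin (numStates i)
  bridge : ∀ i : Fin k, BridgeLabel C (n i.castSucc) (n i.succ)
  /-- bases and periods of the linear sets `L(e)` -/
  base : ∀ i, Fin (numEdges i) → Pair (n i) (n i)
  periods : ∀ i, Fin (numEdges i) → Finset (Pair (n i) (n i))
  bridgeBase : ∀ i : Fin k, Pair (n i.castSucc) (n i.succ)
  bridgePeriods : ∀ i : Fin k, Finset (Pair (n i.castSucc) (n i.succ))

namespace MEVASS

variable {C : RelClass} (V : MEVASS C)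

/-- States of the `i`-th component. -/
abbrev State (i : Fin (V.k + 1)) := Fin (V.numStates i)

/-- Edges inside the `i`-th component. -/
abbrev Edge (i : Fin (V.k + 1)) := Fin (V.numEdges i)

/-- The size of (the representation of) an m-eVASS. -/
def size : ℕ :=
  (∑ i, (1 + V.n i + V.numStates i +
    ∑ e : V.Edge i, (1 + (V.label i e).size + pairSize (V.base i e) +
      ∑ p ∈ V.periods i e, (1 + pairSize p)))) +
  ∑ i : Fin V.k, (1 + (V.bridge i).size + pairSize (V.bridgeBase i) +
    ∑ p ∈ V.bridgePeriods i, (1 + pairSize p))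

/-! #### Reachability inside a component, and the dimension -/

/-- One step between configurations of the `i`-th component. -/
def Step (i : Fin (V.k + 1)) (c c' : V.State i × Vec (V.n i)) : Prop :=
  ∃ e, V.src i e = c.1 ∧ V.tgt i e = c'.1 ∧ (c.2, c'.2) ∈ (V.label i e).set

/-- The reachability relation of the `i`-th component between two of its states. -/
def Reach (i : Fin (V.k + 1)) (p q : V.State i) : Set (Pair (V.n i) (V.n i)) :=
  {z | Relation.ReflTransGen (V.Step i) (p, z.1) (q, z.2)}

/-- The dimension of an m-eVASS: the maximum over all states `q` of the dimension of the rational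
vector space generated by the effects of the runs from `q` to `q` (which stay in the component
of `q`). -/
noncomputable def dim : ℕ :=
  Finset.univ.sup fun q : (Σ i, V.State i) =>
    Module.finrank ℚ (Submodule.span ℚ
      {v : Fin (V.n q.1) → ℚ | ∃ z ∈ V.Reach q.1 q.2 q.2, v = fun j => (effect z j : ℚ)})

/-! #### The characteristic system -/

/-- The variables of the characteristic system: source variables `x_{i,j}`, target variables
`y_{i,j}`, edge variables, period variables of edges inside components, and period variables
of bridges. -/
abbrev Var :=
  (Σ i, Fin (V.n i)) ⊕ (Σ i, Fin (V.n i)) ⊕ (Σ i, V.Edge i) ⊕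
    (Σ i, Σ e : V.Edge i, V.periods i e) ⊕ (Σ i : Fin V.k, V.bridgePeriods i)

/-- The source variable `x_{i,j}`. -/
def srcVar (i : Fin (V.k + 1)) (j : Fin (V.n i)) : V.Var := .inl ⟨i, j⟩

/-- The target variable `y_{i,j}`. -/
def tgtVar (i : Fin (V.k + 1)) (j : Fin (V.n i)) : V.Var := .inr (.inl ⟨i, j⟩)

/-- The edge variable `#(e)`. -/
def edgeVar (i : Fin (V.k + 1)) (e : V.Edge i) : V.Var := .inr (.inr (.inl ⟨i, e⟩))

/-- The variable `#(p)` of a period `p` of an edge `e` inside a component. -/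
def periodVar (i : Fin (V.k + 1)) (e : V.Edge i) (p : V.periods i e) : V.Var :=
  .inr (.inr (.inr (.inl ⟨i, e, p⟩)))

/-- The variable `#(p)` of a period `p` of a bridge. -/
def bridgePeriodVar (i : Fin V.k) (p : V.bridgePeriods i) : V.Var :=
  .inr (.inr (.inr (.inr ⟨i, p⟩)))

/-- Assignments of natural numbers to the variables. -/
abbrev Assignment := V.Var → ℕ

/-- The source configuration of the `i`-th component in an assignment. -/
def source (s : V.Assignment) (i : Fin (V.k + 1)) : Vec (V.n i) := fun j => s (V.srcVar i j)

/-- The target configuration of the `i`-th component in an assignment. -/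
def target (s : V.Assignment) (i : Fin (V.k + 1)) : Vec (V.n i) := fun j => s (V.tgtVar i j)

/-- The Euler-Kirchhoff equations of the `i`-th component. -/
def EulerKirchhoff (s : V.Assignment) (i : Fin (V.k + 1)) : Prop :=
  ∀ q : V.State i,
    (∑ e : V.Edge i with V.tgt i e = q, (s (V.edgeVar i e) : ℤ)) -
      (∑ e : V.Edge i with V.src i e = q, (s (V.edgeVar i e) : ℤ)) =
    (if q = V.qfin i then 1 else 0) - (if q = V.qin i then 1 else 0)

/-- The effect equation of the `i`-th component: the difference of target and source is the effect
of the bases of the used edges plus the effect of the used periods. -/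
def EffectEquation (s : V.Assignment) (i : Fin (V.k + 1)) : Prop :=
  effect (V.source s i, V.target s i) =
    ∑ e : V.Edge i, ((s (V.edgeVar i e) : ℤ) • effect (V.base i e) +
      ∑ p : V.periods i e, (s (V.periodVar i e p) : ℤ) • effect p.1)

/-- The `i`-th bridge: `(y_i, x_{i+1})` is in the linear set of the bridge. -/
def BridgeEquation (s : V.Assignment) (i : Fin V.k) : Prop :=
  (V.target s i.castSucc, V.source s i.succ) =
    V.bridgeBase i + ∑ p : V.bridgePeriods i, s (V.bridgePeriodVar i p) • p.1

/-- The solution set of the characteristic system. -/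
def sol : Set V.Assignment :=
  {s | (∀ i, V.EulerKirchhoff s i ∧ V.EffectEquation s i) ∧ ∀ i, V.BridgeEquation s i}

/-- A variable is unbounded if solutions assign arbitrarily large values to it. -/
def Unbounded (v : V.Var) : Prop := ∀ N : ℕ, ∃ s ∈ V.sol, N ≤ s v

/-! #### Perfectness -/

/-- Perfectness, relative to the bound `g` for the overapproximations of the edges. -/
structure Perfect (g : ℕ → ℕ) : Prop where
  /-- every edge has a basic linear asymptotic overapproximation -/
  basic : ∀ i e, V.base i e ∈ (V.label i e).set
  approx : ∀ i e, AsympOverapprox pairSize g (V.label i e).size (V.label i e).set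
    {V.base i e} (V.periods i e)
  bridge_basic : ∀ i, V.bridgeBase i ∈ (V.bridge i).set
  bridge_approx : ∀ i, AsympOverapprox pairSize g (V.bridge i).size (V.bridge i).set
    {V.bridgeBase i} (V.bridgePeriods i)
  /-- bridge period variables are unbounded -/
  bridge_unbounded : ∀ i p, V.Unbounded (V.bridgePeriodVar i p)
  /-- bounded source and target variables have a unique value -/
  source_unique : ∀ i j, ¬ V.Unbounded (V.srcVar i j) →
    ∀ s ∈ V.sol, ∀ s' ∈ V.sol, s (V.srcVar i j) = s' (V.srcVar i j)
  target_unique : ∀ i j, ¬ V.Unbounded (V.tgtVar i j) →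
    ∀ s ∈ V.sol, ∀ s' ∈ V.sol, s (V.tgtVar i j) = s' (V.tgtVar i j)
  /-- a counter of a nontrivial component with bounded source and target variable is changed
  by some cycle -/
  cycle : ∀ i, 0 < V.numEdges i → ∀ j, ¬ V.Unbounded (V.srcVar i j) →
    ¬ V.Unbounded (V.tgtVar i j) → ∃ q, ∃ z ∈ V.Reach i q q, effect z j ≠ 0
  /-- edge variables and period variables of components are unbounded -/
  edge_unbounded : ∀ i e, V.Unbounded (V.edgeVar i e)
  period_unbounded : ∀ i e p, V.Unbounded (V.periodVar i e p)
  /-- every configuration of a nontrivial component can be forwards- and backwards-covered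
  (a trivial component has no runs that could pump, and nothing is required of it) -/
  forward_cover : ∀ i, 0 < V.numEdges i → ∀ (p : V.State i) (x : Vec (V.n i)),
    ∃ z ∈ V.Reach i (V.qin i) p, (∃ s ∈ V.sol, z.1 = V.source s i) ∧ x ≤ z.2
  backward_cover : ∀ i, 0 < V.numEdges i → ∀ (p : V.State i) (x : Vec (V.n i)),
    ∃ z ∈ V.Reach i p (V.qfin i), x ≤ z.1 ∧ ∃ s ∈ V.sol, z.2 = V.target s i

/-! #### Runs and the solutions they induce -/

/-- Runs inside the `i`-th component from `q(x)` to `q'(y)`. Every step `(x, y)` of an edge `e` is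
recorded with the numbers `c p` of uses of the periods `p` of `e` in this step: `(x, y)` is the base
of `e` plus the used periods, lifted by some `(a, a)` (the relation of `e` is monotone). -/
inductive ComponentRun (i : Fin (V.k + 1)) :
    V.State i → Vec (V.n i) → V.State i → Vec (V.n i) → Type
  | nil (q : V.State i) (x : Vec (V.n i)) : ComponentRun i q x q x
  | cons (e : V.Edge i) (x y a : Vec (V.n i)) (c : Pair (V.n i) (V.n i) → ℕ)
      (mem : (x, y) ∈ (V.label i e).set)
      (decomp : (x, y) = V.base i e + ∑ p ∈ V.periods i e, c p • p + (a, a))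
      {q : V.State i} {z : Vec (V.n i)} (rest : ComponentRun i (V.tgt i e) y q z) :
      ComponentRun i (V.src i e) x q z

/-- The number of uses of an edge in a run. -/
def ComponentRun.edgeCount {V : MEVASS C} {i : Fin (V.k + 1)} :
    {p q : V.State i} → {x y : Vec (V.n i)} → V.ComponentRun i p x q y → V.Edge i → ℕ
  | _, _, _, _, .nil _ _, _ => 0
  | _, _, _, _, .cons e _ _ _ _ _ _ rest, e' => (if e = e' then 1 else 0) + rest.edgeCount e'

/-- The total number of uses of a period of an edge in a run. -/
def ComponentRun.periodCount {V : MEVASS C} {i : Fin (V.k + 1)} :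
    {p q : V.State i} → {x y : Vec (V.n i)} → V.ComponentRun i p x q y → V.Edge i →
      Pair (V.n i) (V.n i) → ℕ
  | _, _, _, _, .nil _ _, _, _ => 0
  | _, _, _, _, .cons e _ _ _ c _ _ rest, e', p =>
      (if e = e' then c p else 0) + rest.periodCount e' p

/-- Runs from the initial to the final state: they run through all components, and between two
consecutive ones through the bridge, where the numbers of uses of the periods are recorded. -/
structure Run where
  entry : ∀ i, Vec (V.n i)
  exit : ∀ i, Vec (V.n i)
  component : ∀ i, V.ComponentRun i (V.qin i) (entry i) (V.qfin i) (exit i)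
  uses : ∀ i : Fin V.k, Pair (V.n i.castSucc) (V.n i.succ) → ℕ
  bridge_mem : ∀ i : Fin V.k, (exit i.castSucc, entry i.succ) ∈ (V.bridge i).set
  bridge_decomp : ∀ i : Fin V.k, (exit i.castSucc, entry i.succ) =
    V.bridgeBase i + ∑ p ∈ V.bridgePeriods i, uses i p • p

/-- The solution of the characteristic system that is induced by a run. -/
def Run.sol {V : MEVASS C} (r : V.Run) : V.Assignment
  | .inl ⟨i, j⟩ => r.entry i j
  | .inr (.inl ⟨i, j⟩) => r.exit i j
  | .inr (.inr (.inl ⟨i, e⟩)) => (r.component i).edgeCount e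
  | .inr (.inr (.inr (.inl ⟨i, e, p⟩))) => (r.component i).periodCount e p
  | .inr (.inr (.inr (.inr ⟨i, p⟩))) => r.uses i p

/-- The set of concretizable solutions. -/
def concretizable : Set V.Assignment := {s ∈ V.sol | ∃ r : V.Run, r.sol = s}

end MEVASS

end EVASS

namespace EVASS

/-! ### Bounds in the fast-growing hierarchy -/

/-! The proof is Lambert's pumping argument with explicit bounds. Differences of two solutions are
homogeneous solutions, and adding a homogeneous solution preserves `sol`; Dickson's lemma turns this
closure property into hybridlinearity (`exists_eq_hybrid`).

For a solution `x` and a full combination `w` of periods, every unbounded variable is positive in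
`w`. In a non-trivial component the solution `x + m • w`, with `m = r + t * M`, is realized by four
blocks: `t` copies of a loop at the initial state that pumps the counters up, one path that uses `x
+ r • w`, `t` copies of a cycle that uses `M • w` minus the uses of the two loops, and `t` copies of
a loop at the final state that pumps down (`exists_hasRun_add_mul`). Path and cycle are Euler walks,
which exist because `w` uses every edge. The last use of an edge on a walk carries all its periods
and every other use is the base alone; the relation contains the former because the coefficients
include a large multiple of `w`, and the latter because edges are basic.

The quantitative core is a bound for the two loops. Perfectness provides covering runs from (to) the
values of some solution, and these agree with `x` wherever `w` vanishes. Short covering runs are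
obtained by Rackoff's induction on the set of counted coordinates (`cov_bounded`). Since a
transition of an eVASS may be arbitrarily large, each one is first replaced by a small one that
agrees with it below a threshold (`exists_truncation_bound`): the intersection of the relation with
a threshold set is again in the class, the running times bound the representations of its
approximating pieces, and a non-empty piece has a small element.

One coordinate costs one application of a function bounded by an iterate of `F_α`. The number of
iterations is therefore linear in the total size, and the resulting `N` is at most `F_{α+1}` of a
linear function, which lies below a member of level `α + 2d + 2`. -/

theorem fastF_mono_and_lt (a : ℕ) :
    Monotone (fastF (a + 1)) ∧ ∀ y, 1 ≤ y → y + 1 ≤ fastF (a + 1) y := by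
  induction a with
  | zero =>
    refine ⟨fun x y h => ?_, fun y h => ?_⟩ <;> simp only [fastF] <;> omega
  | succ a ih =>
    -- Strict growth fails at 0, since `F 1 0 = 0`; iterates that start at 1 stay positive, so
    -- growth at positive arguments suffices.
    have key : ∀ m, m + 1 ≤ (fastF (a + 1))^[m] 1 := by
      intro m
      induction m with
      | zero => simp
      | succ m ihm =>
        rw [Function.iterate_succ_apply']
        have := ih.2 _ (le_trans (by omega) ihm)
        omega
    refine ⟨monotone_nat_of_le_succ fun m => ?_, fun y _ => key y⟩
    simp only [fastF]
    rw [Function.iterate_succ_apply']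
    have := ih.2 _ (le_trans (by omega) (key m))
    omega

theorem fastF_mono (a : ℕ) : Monotone (fastF a) := by
  cases a with
  | zero => exact fun x y h => by simpa [fastF] using h
  | succ a => exact (fastF_mono_and_lt a).1

theorem lt_fastF (a x : ℕ) : x + 1 ≤ fastF (a + 2) x := by
  rcases Nat.eq_zero_or_pos x with rfl | h
  · simp [fastF]
  · exact (fastF_mono_and_lt (a + 1)).2 x h

theorem fastF_zero_le (a : ℕ) : fastF a 0 ≤ 1 := by
  rcases a with _ | _ | a <;> simp [fastF]

theorem fastF_le_succ (a m : ℕ) : fastF (a + 1) m ≤ fastF (a + 2) m := by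
  cases m with
  | zero => exact (fastF_zero_le _).trans (by simp [fastF])
  | succ m =>
    have h : fastF (a + 2) (m + 1) = fastF (a + 1) (fastF (a + 2) m) := by
      simp only [fastF]; rw [Function.iterate_succ_apply']
    rw [h]
    exact fastF_mono _ (lt_fastF a m)

theorem fastF_le_fastF {a b : ℕ} (ha : 1 ≤ a) (hab : a ≤ b) (m : ℕ) : fastF a m ≤ fastF b m := by
  induction b, hab using Nat.le_induction with
  | base => exact le_rfl
  | succ b hb ih =>
    obtain ⟨b, rfl⟩ : ∃ c, b = c + 1 := ⟨b - 1, by omega⟩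
    exact ih.trans (fastF_le_succ b m)

theorem fastF_two (m : ℕ) : fastF 2 m = 2 ^ m := by
  induction m with
  | zero => simp [fastF]
  | succ m ih =>
    have h : fastF 2 (m + 1) = fastF 1 (fastF 2 m) := by
      simp only [fastF]; rw [Function.iterate_succ_apply']
    rw [h, ih, pow_succ]; simp only [fastF]; omega

/-- Functions bounded by some iterate of `fastF a`. -/
def Bd (a : ℕ) (f : ℕ → ℕ) : Prop := ∃ k, ∀ x, f x ≤ (fastF a)^[k] x

section

variable {a : ℕ} (ha : 2 ≤ a)
include ha

theorem succ_le_fastF (x : ℕ) : x + 1 ≤ fastF a x := by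
  obtain ⟨b, rfl⟩ : ∃ b, a = b + 2 := ⟨a - 2, by omega⟩
  exact lt_fastF b x

theorem two_pow_le_fastF (x : ℕ) : 2 ^ x ≤ fastF a x := by
  rw [← fastF_two]; exact fastF_le_fastF (by omega) ha x

theorem add_le_iterate_fastF (k x : ℕ) : x + k ≤ (fastF a)^[k] x := by
  induction k with
  | zero => simp
  | succ k ih =>
    rw [Function.iterate_succ_apply']
    have := succ_le_fastF ha ((fastF a)^[k] x)
    omega

omit ha in
theorem iterate_fastF_mono (k : ℕ) : Monotone (fastF a)^[k] := (fastF_mono a).iterate k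

theorem iterate_fastF_le {k l : ℕ} (h : k ≤ l) (x : ℕ) : (fastF a)^[k] x ≤ (fastF a)^[l] x := by
  obtain ⟨c, rfl⟩ := Nat.exists_eq_add_of_le h
  rw [Function.iterate_add_apply]
  exact iterate_fastF_mono k (le_trans (by omega) (add_le_iterate_fastF ha c x))

theorem two_mul_le_fastF (x : ℕ) : 2 * x ≤ fastF a x := by
  have := fastF_le_fastF (le_refl 1) (show 1 ≤ a by omega) x
  simpa [fastF] using this

namespace Bd

omit ha in
theorem id : Bd a fun x => x := ⟨0, fun _ => le_rfl⟩

theorem const (c : ℕ) : Bd a fun _ => c :=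
  ⟨c, fun x => (Nat.le_add_left c x).trans (add_le_iterate_fastF ha c x)⟩

omit ha in
theorem mono {f g : ℕ → ℕ} (hg : Bd a g) (h : ∀ x, f x ≤ g x) : Bd a f := by
  obtain ⟨k, hk⟩ := hg
  exact ⟨k, fun x => (h x).trans (hk x)⟩

omit ha in
theorem comp {f g : ℕ → ℕ} (hf : Bd a f) (hg : Bd a g) : Bd a fun x => f (g x) := by
  obtain ⟨k, hk⟩ := hf
  obtain ⟨l, hl⟩ := hg
  refine ⟨k + l, fun x => (hk _).trans ?_⟩
  rw [Function.iterate_add_apply]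
  exact iterate_fastF_mono k (hl x)

omit ha in
theorem fastF_self : Bd a (fastF a) := ⟨1, fun _ => le_rfl⟩

omit ha in
theorem iterate (k : ℕ) : Bd a (fastF a)^[k] := ⟨k, fun _ => le_rfl⟩

theorem exists_common {f g : ℕ → ℕ} (hf : Bd a f) (hg : Bd a g) :
    ∃ k, ∀ x, f x ≤ (fastF a)^[k] x ∧ g x ≤ (fastF a)^[k] x := by
  obtain ⟨k, hk⟩ := hf
  obtain ⟨l, hl⟩ := hg
  exact ⟨max k l, fun x => ⟨(hk x).trans (iterate_fastF_le ha (le_max_left _ _) x),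
    (hl x).trans (iterate_fastF_le ha (le_max_right _ _) x)⟩⟩

theorem add {f g : ℕ → ℕ} (hf : Bd a f) (hg : Bd a g) : Bd a fun x => f x + g x := by
  obtain ⟨k, hk⟩ := exists_common ha hf hg
  refine ⟨k + 1, fun x => ?_⟩
  rw [Function.iterate_succ_apply']
  exact (add_le_add (hk x).1 (hk x).2).trans
    ((two_mul _).symm.le.trans (two_mul_le_fastF ha ((fastF a)^[k] x)))

theorem two_pow {f : ℕ → ℕ} (hf : Bd a f) : Bd a fun x => 2 ^ f x :=
  (fastF_self (a := a)).comp hf |>.mono fun x => two_pow_le_fastF ha (f x)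

/-- Since `a ≥ 2`, exponentials are available, and a product is at most the power of two of the sum.
-/
theorem mul {f g : ℕ → ℕ} (hf : Bd a f) (hg : Bd a g) : Bd a fun x => f x * g x := by
  refine (two_pow ha (add ha hf hg)).mono fun x => ?_
  rw [pow_add]
  exact Nat.mul_le_mul Nat.lt_two_pow_self.le Nat.lt_two_pow_self.le

theorem pow {f g : ℕ → ℕ} (hf : Bd a f) (hg : Bd a g) : Bd a fun x => f x ^ g x := by
  refine (two_pow ha (mul ha hf hg)).mono fun x => ?_
  rw [pow_mul]
  exact Nat.pow_le_pow_left Nat.lt_two_pow_self.le _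

theorem eval (p : Polynomial ℕ) : Bd a fun x => p.eval x := by
  induction p using Polynomial.induction_on' with
  | add p q hp hq => simpa using add ha hp hq
  | monomial n c => simpa using mul ha (const ha c) (pow ha id (const ha n))

/-- Levels consist of compositions of a rigid shape. Passing to upper bounds by iterates of a single
function gives a class that is closed under composition and arithmetic. -/
theorem of_mem_level {e : ℕ} (he : e ≤ a) {f : ℕ → ℕ} (hf : f ∈ level e) : Bd a f := by
  induction e generalizing f with
  | zero => obtain ⟨p, rfl⟩ := hf; exact eval ha p
  | succ e ih =>
    obtain ⟨rs, hrs, rfl⟩ := hf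
    have h1 : Bd a (rs.foldr (fun r h => r ∘ h) _root_.id) := by
      induction rs with
      | nil => exact id
      | cons r rs ihr =>
        exact (ih (by omega) (hrs r (by simp))).comp
          (ihr fun r' h' => hrs r' (List.mem_cons_of_mem _ h'))
    exact (fastF_self.comp h1).mono fun x => fastF_le_fastF (by omega) he _

end Bd

/-- Because `x ≤ F_a^{(x)}(1)`, another `k` iterations stay below `F_a^{(k+x)}(1)`. This is the only
place where the number of iterations is traded for the next level. -/
theorem iterate_fastF_le_fastF_succ (k x : ℕ) : (fastF a)^[k] x ≤ fastF (a + 1) (k + x) := by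
  obtain ⟨b, rfl⟩ : ∃ b, a = b + 2 := ⟨a - 2, by omega⟩
  simp only [fastF.eq_3]
  rw [Function.iterate_add_apply]
  exact iterate_fastF_mono k (le_trans (by omega) (add_le_iterate_fastF ha x 1))

end

theorem exists_mem_level_ge (c e : ℕ) : ∃ f ∈ level e, ∀ x, c * x + c ≤ f x := by
  induction e with
  | zero => exact ⟨_, ⟨Polynomial.C c * Polynomial.X + Polynomial.C c, rfl⟩, by simp⟩
  | succ e ih =>
    obtain ⟨f, hf, h⟩ := ih
    refine ⟨_, ⟨[f], by simpa using hf, rfl⟩, fun x => (h x).trans ?_⟩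
    rcases Nat.eq_zero_or_pos (f x) with h0 | h0
    · omega
    · exact ((fastF_mono_and_lt e).2 (f x) h0).trans' (by omega)

theorem exists_mem_level_ge_fastF {a e : ℕ} (ha : 1 ≤ a) (hae : a ≤ e + 1) (c : ℕ) :
    ∃ f ∈ level (e + 1), ∀ x, fastF a (c * x + c) ≤ f x := by
  obtain ⟨f, hf, h⟩ := exists_mem_level_ge c e
  exact ⟨_, ⟨[f], by simpa using hf, rfl⟩,
    fun x => (fastF_mono a (h x)).trans (fastF_le_fastF ha hae _)⟩

/-! ### The length of the output of a Turing machine -/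

/-- The number of push instructions of a statement. -/
def pushes {K : Type} {Γ : K → Type} {Λ σ : Type} : Turing.TM2.Stmt Γ Λ σ → ℕ
  | .push _ _ q => pushes q + 1
  | .peek _ _ q => pushes q
  | .pop _ _ q => pushes q
  | .load _ q => pushes q
  | .branch _ q₁ q₂ => pushes q₁ + pushes q₂
  | .goto _ => 0
  | .halt => 0

theorem sum_length_stepAux {K : Type} [DecidableEq K] [Fintype K] {Γ : K → Type} {Λ σ : Type}
    (q : Turing.TM2.Stmt Γ Λ σ) (v : σ) (S : ∀ k, List (Γ k)) :
    ∑ k, ((Turing.TM2.stepAux q v S).stk k).length ≤ ∑ k, (S k).length + pushes q := by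
  induction q generalizing v S with
  | push k f q ih =>
    simp only [Turing.TM2.stepAux, pushes]
    refine (ih _ _).trans ?_
    have : ∑ k', (Function.update S k (f v :: S k) k').length ≤
        ∑ k', ((S k').length + if k' = k then 1 else 0) := by
      refine Finset.sum_le_sum fun k' _ => ?_
      rcases eq_or_ne k' k with rfl | h
      · simp
      · simp [h]
    rw [Finset.sum_add_distrib] at this
    simp at this
    omega
  | peek k f q ih => exact ih _ _
  | pop k f q ih =>
    simp only [Turing.TM2.stepAux, pushes]
    refine (ih _ _).trans (Nat.add_le_add_right (Finset.sum_le_sum fun k' _ => ?_) _)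
    rcases eq_or_ne k' k with rfl | h
    · simp
    · simp [h]
  | load f q ih => exact ih _ _
  | branch f q₁ q₂ ih₁ ih₂ =>
    simp only [Turing.TM2.stepAux, pushes]
    cases f v
    · exact (ih₂ _ _).trans (by omega)
    · exact (ih₁ _ _).trans (by omega)
  | goto f => simp [Turing.TM2.stepAux, pushes]
  | halt => simp [Turing.TM2.stepAux, pushes]

theorem measure_evals_le {σ : Type} (f : σ → Option σ) (μ : σ → ℕ) (c : ℕ)
    (hf : ∀ a b, f a = some b → μ b ≤ μ a + c) (k : ℕ) (a b : σ)
    (h : (flip bind f)^[k] (some a) = some b) : μ b ≤ μ a + k * c := by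
  induction k generalizing b with
  | zero => simp at h; subst h; simp
  | succ k ih =>
    rw [Function.iterate_succ_apply'] at h
    cases h1 : (flip bind f)^[k] (some a) with
    | none => rw [h1] at h; simp [flip] at h
    | some d =>
      rw [h1] at h
      have h2 := hf d b (by simpa [flip] using h)
      have h3 := ih d h1
      rw [add_mul, one_mul]
      omega

theorem sum_length_initList (tm : Turing.FinTM2) (s : List (tm.Γ tm.k₀)) :
    letI := tm.kFin
    ∑ k, ((Turing.initList tm s).stk k).length = s.length := by
  let := tm.kFin
  rw [Finset.sum_eq_single tm.k₀]
  · simp [Turing.initList]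
  · intro k _ hk
    simp [Turing.initList, hk]
  · simp

/-- One machine step executes the statement of one label, hence pushes at most a constant number of
symbols. The total stack height grows at most by this constant per step, and the output is one of
the stacks. -/
theorem exists_output_length_le {A B Γ₀ Γ₁ : Type} {ea : A → List Γ₀} {eb : B → List Γ₁}
    {f : A → B} (T : Turing.TM2ComputableInTime ea eb f) :
    ∃ c, ∀ a, (eb (f a)).length ≤ (ea a).length + T.time (ea a).length * c := by
  let := T.tm.kFin
  let := T.tm.ΛFin
  refine ⟨∑ l, pushes (T.tm.m l), fun a => ?_⟩
  have h := T.outputsFun a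
  have key := measure_evals_le T.tm.step (fun d => ∑ k, (d.stk k).length)
    (∑ l, pushes (T.tm.m l)) ?_ h.steps _ _ h.evals_in_steps
  · have h1 : (eb (f a)).length ≤ ∑ k, ((Turing.haltList T.tm
        (List.map T.outputAlphabet.invFun (eb (f a)))).stk k).length := by
      refine le_trans ?_ (Finset.single_le_sum (fun _ _ => Nat.zero_le _)
        (Finset.mem_univ T.tm.k₁))
      simp [Turing.haltList]
    have h2 := sum_length_initList T.tm (List.map T.inputAlphabet.invFun (ea a))
    rw [List.length_map] at h2
    have h3 := Nat.mul_le_mul_right (∑ l, pushes (T.tm.m l)) h.steps_le_m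
    exact (h1.trans key).trans (by rw [h2]; omega)
  · rintro ⟨_ | l, v, S⟩ b hb
    · simp [Turing.TM2.step] at hb
    · simp only [Turing.FinTM2.step, Turing.TM2.step] at hb
      obtain rfl := Option.some.inj hb
      refine (sum_length_stepAux _ v S).trans (Nat.add_le_add_left ?_ _)
      exact Finset.single_le_sum (f := fun l => pushes (T.tm.m l)) (fun _ _ => Nat.zero_le _)
        (Finset.mem_univ l)

/-! ### Lengths of encodings -/

theorem length_bracket (w : List Sym) : (bracket w).length = w.length + 2 := by
  simp [bracket]

theorem length_encBits (w : List Bool) : (encBits w).length = w.length + 2 := by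
  simp [encBits, length_bracket]

theorem length_encNat (a : ℕ) : (encNat a).length = Nat.size a + 2 := by
  rw [encNat, length_encBits, Nat.size_eq_bits_len]

theorem length_encList {β : Type} (enc : β → List Sym) (l : List β) :
    (encList enc l).length = (l.map fun x => (enc x).length).sum + 2 := by
  rw [encList, length_bracket, List.length_flatMap]

theorem length_encList_le {β : Type} (enc : β → List Sym) (l : List β) (c : ℕ)
    (h : ∀ x ∈ l, (enc x).length ≤ c) : (encList enc l).length ≤ l.length * c + 2 := by
  rw [length_encList]
  have := List.sum_le_card_nsmul (l.map fun x => (enc x).length) c (by simpa using h)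
  simpa using this

theorem length_enc_le {β : Type} (enc : β → List Sym) {l : List β} {x : β} (hx : x ∈ l) :
    (enc x).length ≤ (encList enc l).length := by
  rw [length_encList]
  have := List.single_le_sum (l := l.map fun x => (enc x).length) (by simp) _
    (List.mem_map_of_mem hx)
  omega

theorem length_le_encList {β : Type} (enc : β → List Sym) (l : List β)
    (h : ∀ x ∈ l, 1 ≤ (enc x).length) : l.length ≤ (encList enc l).length := by
  rw [length_encList]
  have := List.card_nsmul_le_sum (l.map fun x => (enc x).length) 1 (by simpa using h)
  simp at this
  omega

theorem length_encVec {n : ℕ} (x : Vec n) : (encVec x).length = ∑ j, (Nat.size (x j) + 2) + 2 := by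
  rw [encVec, length_encList, List.map_ofFn, List.sum_ofFn]
  simp [length_encNat]

theorem vecSize_le_length {n : ℕ} (x : Vec n) : vecSize x ≤ (encVec x).length := by
  rw [length_encVec, vecSize]
  exact (Finset.sum_le_sum fun j _ => by omega).trans (Nat.le_add_right _ 2)

theorem pairSize_le_length {m n : ℕ} (z : Pair m n) : pairSize z ≤ (encPair z).length := by
  rw [encPair, List.length_append]
  exact add_le_add (vecSize_le_length _) (vecSize_le_length _)

theorem size_le_self (a : ℕ) : Nat.size a ≤ a := Nat.size_le.2 Nat.lt_two_pow_self

theorem length_encVec_le {n : ℕ} (x : Vec n) (c : ℕ) (h : ∀ j, x j ≤ c) :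
    (encVec x).length ≤ n * (c + 2) + 2 := by
  rw [length_encVec]
  refine Nat.add_le_add_right ((Finset.sum_le_card_nsmul _ _ (c + 2) fun j _ => ?_).trans
    (by simp)) 2
  exact Nat.add_le_add_right ((size_le_self _).trans (h j)) 2

theorem length_encPair_le {m n : ℕ} (z : Pair m n) (c : ℕ) (h : ∀ j, z.1 j ≤ c)
    (h' : ∀ j, z.2 j ≤ c) : (encPair z).length ≤ (m + n) * (c + 2) + 4 := by
  rw [encPair, List.length_append]
  have := length_encVec_le z.1 c h
  have := length_encVec_le z.2 c h'
  rw [add_mul]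
  omega

theorem vecSize_le {ι : Type} [Fintype ι] (x : ι → ℕ) (c : ℕ) (h : ∀ j, x j ≤ c) :
    vecSize x ≤ Fintype.card ι * (c + 1) :=
  (Finset.sum_le_card_nsmul _ _ (c + 1) fun j _ =>
    Nat.add_le_add_right ((size_le_self _).trans (h j)) 1).trans (by simp)

theorem pairSize_le {m n : ℕ} (z : Pair m n) (c : ℕ) (h : ∀ j, z.1 j ≤ c)
    (h' : ∀ j, z.2 j ≤ c) : pairSize z ≤ (m + n) * (c + 1) := by
  have h1 := vecSize_le z.1 c h
  have h2 := vecSize_le z.2 c h'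
  simp only [Fintype.card_fin] at h1 h2
  rw [pairSize, add_mul]
  omega

theorem lt_two_pow_vecSize {ι : Type} [Fintype ι] (x : ι → ℕ) (j : ι) : x j < 2 ^ vecSize x := by
  refine (Nat.lt_size_self (x j)).trans_le (Nat.pow_le_pow_right (by norm_num) ?_)
  have := Finset.single_le_sum (f := fun j => Nat.size (x j) + 1) (fun _ _ => Nat.zero_le _)
    (Finset.mem_univ j)
  exact (Nat.le_succ _).trans this

theorem fst_lt_two_pow_pairSize {m n : ℕ} (z : Pair m n) (j : Fin m) : z.1 j < 2 ^ pairSize z :=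
  (lt_two_pow_vecSize _ j).trans_le (Nat.pow_le_pow_right (by norm_num) (Nat.le_add_right _ _))

theorem snd_lt_two_pow_pairSize {m n : ℕ} (z : Pair m n) (j : Fin n) : z.2 j < 2 ^ pairSize z :=
  (lt_two_pow_vecSize _ j).trans_le (Nat.pow_le_pow_right (by norm_num) (Nat.le_add_left _ _))

/-! ### Hybridlinear sets -/

section Hybridlinear

variable {M : Type} [AddCommMonoid M] {B F : Finset M}

theorem mem_hybrid_of_mem {b : M} (hb : b ∈ B) : b ∈ hybrid B F :=
  ⟨b, hb, 0, by simp⟩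

theorem hybrid_add_nsmul {x f : M} (hx : x ∈ hybrid B F) (hf : f ∈ F) (k : ℕ) :
    x + k • f ∈ hybrid B F := by
  classical
  obtain ⟨b, hb, c, rfl⟩ := hx
  refine ⟨b, hb, fun g => c g + if g = f then k else 0, ?_⟩
  simp [add_smul, Finset.sum_add_distrib, ite_smul, hf, add_assoc]

theorem hybrid_add_sum {ι : Type} {x : M} (hx : x ∈ hybrid B F) (s : Finset ι) (f : ι → M)
    (k : ι → ℕ) (h : ∀ i ∈ s, k i = 0 ∨ f i ∈ F) : x + ∑ i ∈ s, k i • f i ∈ hybrid B F := by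
  classical
  induction s using Finset.induction_on with
  | empty => simpa using hx
  | insert i s hi ih =>
    rw [Finset.sum_insert hi, add_comm (k i • f i), ← add_assoc]
    have h1 := ih fun j hj => h j (Finset.mem_insert_of_mem hj)
    rcases h i (Finset.mem_insert_self _ _) with h0 | h0
    · simpa [h0] using h1
    · exact hybrid_add_nsmul h1 h0 _

theorem sum_mem_fullCombinations : ∑ f ∈ F, f ∈ fullCombinations F :=
  ⟨fun _ => 1, fun _ _ => le_rfl, by simp⟩

end Hybridlinear

/-! ### The set of vectors that agree with a given one up to a threshold -/

/-- The unit vectors of the coordinates of `z` that are at least `B`. -/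
def thresholdPeriods {m n : ℕ} (z : Pair m n) (B : ℕ) : List (Pair m n) :=
  ((List.finRange m).filter fun j => B ≤ z.1 j).map (fun j => (Pi.single j 1, 0)) ++
    ((List.finRange n).filter fun j => B ≤ z.2 j).map (fun j => (0, Pi.single j 1))

/-- A description of the linear set of vectors that agree with `z` on the coordinates where `z` is
less than `B`, and are at least `B` elsewhere. -/
def thresholdDesc {m n : ℕ} (z : Pair m n) (B : ℕ) : RelClass.SemilinearDesc m n :=
  [((fun j => min (z.1 j) B, fun j => min (z.2 j) B), thresholdPeriods z B)]

theorem mem_thresholdDesc {m n : ℕ} (z : Pair m n) (B : ℕ) :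
    z ∈ RelClass.semilinearSet (thresholdDesc z B) := by
  classical
  refine ⟨_, List.mem_singleton_self _, ?_⟩
  have h1 : ((fun j => min (z.1 j) B, fun j => min (z.2 j) B) : Pair m n) ∈
      hybrid {((fun j => min (z.1 j) B, fun j => min (z.2 j) B) : Pair m n)}
        (thresholdPeriods z B).toFinset := mem_hybrid_of_mem (Finset.mem_singleton_self _)
  have h2 := hybrid_add_sum h1 Finset.univ (fun j : Fin m => ((Pi.single j 1, 0) : Pair m n))
    (fun j => z.1 j - B) (fun j _ => by
      by_cases h : B ≤ z.1 j
      · right; simp [thresholdPeriods]; exact ⟨j, h, rfl⟩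
      · left; omega)
  have h3 := hybrid_add_sum h2 Finset.univ (fun j : Fin n => ((0, Pi.single j 1) : Pair m n))
    (fun j => z.2 j - B) (fun j _ => by
      by_cases h : B ≤ z.2 j
      · right; simp [thresholdPeriods]; exact ⟨j, h, rfl⟩
      · left; omega)
  convert h3 using 1
  ext j
  · simp [Prod.fst_sum, Finset.sum_apply, Pi.single_apply]
    omega
  · simp [Prod.snd_sum, Finset.sum_apply, Pi.single_apply]
    omega

theorem of_mem_thresholdDesc {m n : ℕ} {z z' : Pair m n} {B : ℕ}
    (h : z' ∈ RelClass.semilinearSet (thresholdDesc z B)) :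
    (∀ j, (z.1 j < B → z'.1 j = z.1 j) ∧ (B ≤ z.1 j → B ≤ z'.1 j)) ∧
      ∀ j, (z.2 j < B → z'.2 j = z.2 j) ∧ (B ≤ z.2 j → B ≤ z'.2 j) := by
  obtain ⟨L, hL, b, hb, c, rfl⟩ := h
  obtain rfl := List.mem_singleton.1 hL
  obtain rfl := Finset.mem_singleton.1 hb
  refine ⟨fun j => ⟨fun hj => ?_, fun hj => ?_⟩, fun j => ⟨fun hj => ?_, fun hj => ?_⟩⟩
  · have : ∑ f ∈ (thresholdPeriods z B).toFinset, c f * f.1 j = 0 := by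
      refine Finset.sum_eq_zero fun f hf => ?_
      simp only [thresholdPeriods, List.mem_toFinset, List.mem_append, List.mem_map,
        List.mem_filter, List.mem_finRange, true_and, decide_eq_true_eq] at hf
      rcases hf with ⟨i, hi, rfl⟩ | ⟨i, hi, rfl⟩
      · have : j ≠ i := by rintro rfl; omega
        simp [this]
      · simp
    simp [Prod.fst_sum, Finset.sum_apply, this]
    omega
  · simp [Prod.fst_sum, Finset.sum_apply]
    omega
  · have : ∑ f ∈ (thresholdPeriods z B).toFinset, c f * f.2 j = 0 := by
      refine Finset.sum_eq_zero fun f hf => ?_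
      simp only [thresholdPeriods, List.mem_toFinset, List.mem_append, List.mem_map,
        List.mem_filter, List.mem_finRange, true_and, decide_eq_true_eq] at hf
      rcases hf with ⟨i, hi, rfl⟩ | ⟨i, hi, rfl⟩
      · simp
      · have : j ≠ i := by rintro rfl; omega
        simp [this]
    simp [Prod.snd_sum, Finset.sum_apply, this]
    omega
  · simp [Prod.snd_sum, Finset.sum_apply]
    omega

theorem length_encSemilinear_thresholdDesc {m n : ℕ} (z : Pair m n) (B : ℕ) :
    (RelClass.encSemilinear (thresholdDesc z B)).length ≤
      ((m + n) * (B + 3) + 4) + ((m + n) * ((m + n) * (B + 3) + 4) + 2) + 2 := by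
  rw [RelClass.encSemilinear, thresholdDesc, length_encList]
  simp only [List.map_cons, List.map_nil, List.sum_cons, List.sum_nil, List.length_append, add_zero]
  refine Nat.add_le_add_right (add_le_add ?_ ?_) 2
  · exact length_encPair_le _ (B + 1) (fun j => (min_le_right _ _).trans (by omega))
      (fun j => (min_le_right _ _).trans (by omega))
  · refine (length_encList_le _ _ ((m + n) * (B + 3) + 4) fun x hx => ?_).trans ?_
    -- The bound is `B + 1` rather than `B` because unit vectors have an entry 1 even if `B = 0`.
    · refine length_encPair_le _ (B + 1) (fun j => ?_) (fun j => ?_) <;>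
      · simp only [thresholdPeriods, List.mem_append, List.mem_map] at hx
        rcases hx with ⟨i, -, rfl⟩ | ⟨i, -, rfl⟩ <;> simp [Pi.single_apply] <;>
          split_ifs <;> omega
    · refine Nat.add_le_add_right (Nat.mul_le_mul_right _ ?_) 2
      simp only [thresholdPeriods, List.length_append, List.length_map]
      exact add_le_add ((List.length_filter_le _ _).trans (by simp))
        ((List.length_filter_le _ _).trans (by simp))

/-- `z'` agrees with `z` on the coordinates where `z` is less than `B`, is at least `B` elsewhere,
and is bounded by `D`. -/
def IsTruncation {ι κ : Type} (B D : ℕ) (z z' : (ι → ℕ) × (κ → ℕ)) : Prop :=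
  (∀ j, (z.1 j < B → z'.1 j = z.1 j) ∧ (B ≤ z.1 j → B ≤ z'.1 j) ∧ z'.1 j ≤ D) ∧
    ∀ j, (z.2 j < B → z'.2 j = z.2 j) ∧ (B ≤ z.2 j → B ≤ z'.2 j) ∧ z'.2 j ≤ D

/-- A nonempty set with an asymptotic overapproximation has a small element. -/
theorem exists_mem_small {C : RelClass} {m n : ℕ} (P : C.Piece m n) {g G : ℕ → ℕ} (hG : Monotone G)
    (hg : ∀ x, g x ≤ G x)
    (h : AsympOverapprox pairSize g P.code.size P.code.set P.bases.toFinset P.periods.toFinset)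
    (hne : P.code.set.Nonempty) {L s : ℕ} (hL : P.enc.length ≤ L) (hs : m + n ≤ s) :
    ∃ z ∈ P.code.set, (∀ j, z.1 j ≤ 2 ^ L + G ((L + s) + L + s * (L * 2 ^ L + 1)) * (L * 2 ^ L)) ∧
      ∀ j, z.2 j ≤ 2 ^ L + G ((L + s) + L + s * (L * 2 ^ L + 1)) * (L * 2 ^ L) := by
  classical
  obtain ⟨hsub, happ⟩ := h
  obtain ⟨z, hz⟩ := hne
  obtain ⟨b, hb, -⟩ := hsub hz
  -- The small element is a base plus `N` times the sum of all periods. The given element serves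
  -- only to show that a base exists.
  obtain ⟨N, hN, hmem⟩ := happ b (mem_hybrid_of_mem hb) _ sum_mem_fullCombinations
  have hlen : P.code.1.length + 2 + (encList encPair P.bases).length +
      (encList encPair P.periods).length ≤ L := by
    simpa [RelClass.Piece.enc, length_encBits, add_assoc] using hL
  have hle : ∀ z ∈ P.bases ++ P.periods, pairSize z ≤ L := by
    intro z hz
    refine (pairSize_le_length z).trans ?_
    rcases List.mem_append.1 hz with h | h <;> have := length_enc_le encPair h <;> omega
  have hpow : ∀ z ∈ P.bases ++ P.periods, (∀ j, z.1 j ≤ 2 ^ L) ∧ ∀ j, z.2 j ≤ 2 ^ L := fun z hz =>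
    ⟨fun j => (fst_lt_two_pow_pairSize z j).le.trans (Nat.pow_le_pow_right (by norm_num) (hle z hz)),
     fun j => (snd_lt_two_pow_pairSize z j).le.trans (Nat.pow_le_pow_right (by norm_num) (hle z hz))⟩
  have hcard : P.periods.toFinset.card ≤ L := by
    refine (List.toFinset_card_le _).trans ((length_le_encList encPair _ fun x _ => ?_).trans
      (by omega : (encList encPair P.periods).length ≤ L))
    rw [encPair, List.length_append, length_encVec]
    omega
  have hb' : b ∈ P.bases ++ P.periods := List.mem_append_left _ (by simpa using hb)
  have hw1 : ∀ j, (∑ f ∈ P.periods.toFinset, f).1 j ≤ L * 2 ^ L := fun j => by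
    rw [Prod.fst_sum, Finset.sum_apply]
    refine (Finset.sum_le_card_nsmul _ _ (2 ^ L) fun f hf => ?_).trans
      (Nat.mul_le_mul_right _ hcard)
    exact (hpow f (List.mem_append_right _ (by simpa using hf))).1 j
  have hw2 : ∀ j, (∑ f ∈ P.periods.toFinset, f).2 j ≤ L * 2 ^ L := fun j => by
    rw [Prod.snd_sum, Finset.sum_apply]
    refine (Finset.sum_le_card_nsmul _ _ (2 ^ L) fun f hf => ?_).trans
      (Nat.mul_le_mul_right _ hcard)
    exact (hpow f (List.mem_append_right _ (by simpa using hf))).2 j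
  have hN' : N ≤ G ((L + s) + L + s * (L * 2 ^ L + 1)) := by
    refine (hN.trans (hg _)).trans (hG (add_le_add (add_le_add ?_ (hle b hb')) ?_))
    · rw [RelClass.Code.size]; omega
    · exact (pairSize_le _ _ hw1 hw2).trans (Nat.mul_le_mul_right _ hs)
  refine ⟨_, hmem N le_rfl, fun j => ?_, fun j => ?_⟩
  · simpa using add_le_add ((hpow b hb').1 j) (Nat.mul_le_mul hN' (hw1 j))
  · simpa using add_le_add ((hpow b hb').2 j) (Nat.mul_le_mul hN' (hw2 j))

/-- Intersect `R` with the set of vectors that agree with `z` below `B` and are at least `B`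
elsewhere. A representation of the intersection, and then one of its approximating pieces, is
computed in time bounded by iterates of `F_α`, so its length is bounded in the same way. The piece
that contains `z` is non-empty and has a small element, which is the desired truncation. -/
theorem exists_truncation_bound {C : RelClass} {α : ℕ} (hα : 2 ≤ α) (hC : C.Approximable α)
    (hI : C.ClosedUnderSemilinearInter α) :
    ∃ k, ∀ {m n : ℕ} (R : C.Code m n), ∀ z ∈ R.set, ∀ B,
      ∃ z' ∈ R.set, IsTruncation B ((fastF α)^[k] (R.size + B)) z z' := by
  obtain ⟨g, hg, out, ⟨T, hT⟩, hout⟩ := hC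
  obtain ⟨out', ⟨T', hT'⟩, hout'⟩ := hI
  obtain ⟨c, hc⟩ := exists_output_length_le T
  obtain ⟨c', hc'⟩ := exists_output_length_le T'
  obtain ⟨kg, hkg⟩ := Bd.of_mem_level hα le_rfl hg
  obtain ⟨kT, hkT⟩ := Bd.of_mem_level hα le_rfl hT
  obtain ⟨kT', hkT'⟩ := Bd.of_mem_level hα le_rfl hT'
  have G : ∀ k, Monotone (fastF α)^[k] := fun k => iterate_fastF_mono k
  have It : ∀ {f : ℕ → ℕ} (k), Bd α f → Bd α fun x => (fastF α)^[k] (f x) := fun k hf =>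
    (Bd.iterate k).comp hf
  have cst := fun c => Bd.const hα c
  have Id : Bd α fun x => x := Bd.id
  -- bounds for the lengths of the first input, the second input, and the final output
  obtain ⟨l₁, hl₁, e₁⟩ : ∃ l, Bd α l ∧ ∀ x, (x + 6) +
      ((x * (x + 3) + 4) + (x * (x * (x + 3) + 4) + 2) + 2) = l x :=
    ⟨_, (Id.add hα (cst _)).add hα ((((Id.mul hα (Id.add hα (cst _))).add hα (cst _)).add hα
      ((Id.mul hα ((Id.mul hα (Id.add hα (cst _))).add hα (cst _))).add hα (cst _))).add hα
      (cst _)), fun _ => rfl⟩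
  obtain ⟨l₂, hl₂, e₂⟩ : ∃ l, Bd α l ∧ ∀ x, x + 6 + (l₁ x + (fastF α)^[kT'] (l₁ x) * c') = l x :=
    ⟨_, (Id.add hα (cst _)).add hα (hl₁.add hα ((It kT' hl₁).mul hα (cst _))), fun _ => rfl⟩
  obtain ⟨l₃, hl₃, e₃⟩ : ∃ l, Bd α l ∧ ∀ x, l₂ x + (fastF α)^[kT] (l₂ x) * c = l x :=
    ⟨_, hl₂.add hα ((It kT hl₂).mul hα (cst _)), fun _ => rfl⟩
  obtain ⟨k, hk⟩ : Bd α fun x => 2 ^ l₃ x + (fastF α)^[kg] ((l₃ x + x) + l₃ x +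
      x * (l₃ x * 2 ^ l₃ x + 1)) * (l₃ x * 2 ^ l₃ x) :=
    (hl₃.two_pow hα).add hα ((It kg (((hl₃.add hα Id).add hα hl₃).add hα (Id.mul hα
      ((hl₃.mul hα (hl₃.two_pow hα)).add hα (cst 1))))).mul hα (hl₃.mul hα (hl₃.two_pow hα)))
  refine ⟨k, fun {m n} R z hz B => ?_⟩
  let R₀ : C.Coded := ⟨m, n, R⟩
  let S := thresholdDesc z B
  let R₁ : C.Coded := ⟨m, n, out' R₀ S⟩
  have hs : R.1.length + m + n = R.size := rfl
  have hlenenc : ∀ R : C.Coded, R.enc.length = R.m + R.n + 6 + R.code.1.length := fun R => by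
    simp [RelClass.Coded.enc, encDim, length_bracket, length_encBits]; ring
  have hset : R₁.code.set = R.set ∩ RelClass.semilinearSet S := hout' R₀ S
  have hzmem : z ∈ R₁.code.set := by rw [hset]; exact ⟨hz, mem_thresholdDesc z B⟩
  obtain ⟨h1, -, h3⟩ := hout R₁
  have hz1 := hzmem
  rw [h1] at hz1
  obtain ⟨P, hP, hzP⟩ := hz1
  have in1 : (R₀.enc ++ RelClass.encSemilinear S).length ≤ l₁ (R.size + B) := by
    rw [List.length_append, hlenenc, ← e₁]
    have h := length_encSemilinear_thresholdDesc z B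
    have h2 : m + n ≤ R.size + B := by omega
    refine add_le_add ?_ (h.trans ?_)
    · change m + n + 6 + R.1.length ≤ _
      omega
    · gcongr <;> omega
  have in2 : R₁.enc.length ≤ l₂ (R.size + B) := by
    rw [hlenenc, ← e₂]
    refine add_le_add (show m + n + 6 ≤ _ by omega) ?_
    have h := hc' ⟨R₀, S⟩
    simp only [id_eq, length_encBits] at h
    refine (Nat.le_of_add_right_le (k := 2) h).trans (add_le_add in1 (Nat.mul_le_mul_right _ ?_))
    exact (hkT' _).trans (G _ in1)
  have hout3 : P.enc.length ≤ l₃ (R.size + B) := by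
    rw [← e₃]
    refine (length_enc_le RelClass.Piece.enc hP).trans ((hc R₁).trans
      (add_le_add in2 (Nat.mul_le_mul_right _ ?_)))
    exact (hkT _).trans (G _ in2)
  obtain ⟨z', hz', hb1, hb2⟩ := exists_mem_small P (G kg) hkg (h3 P hP) ⟨z, hzP⟩ hout3
    (show m + n ≤ R.size + B by omega)
  have hz'mem : z' ∈ R₁.code.set := by rw [h1]; exact ⟨P, hP, hz'⟩
  rw [hset] at hz'mem
  obtain ⟨t1, t2⟩ := of_mem_thresholdDesc hz'mem.2
  exact ⟨z', hz'mem.1, fun j => ⟨(t1 j).1, (t1 j).2, (hb1 j).trans (hk _)⟩,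
    fun j => ⟨(t2 j).1, (t2 j).2, (hb2 j).trans (hk _)⟩⟩

/-! ### Bounds for covering runs of monotone transition systems -/

section Cover

variable {Q ι : Type}

/-- From the state `p` and counters `a`, the state `q` and the vector `t` are covered on the
coordinates in `J` by at most `ℓ` transitions of `T` with entries at most `M`, where the other
coordinates are ignored. -/
inductive Cov (T : Q → (ι → ℕ) → Q → (ι → ℕ) → Prop) (J : Finset ι) (q : Q) (t : ι → ℕ) (M : ℕ) :
    ℕ → Q → (ι → ℕ) → Prop
  | done {ℓ : ℕ} {a : ι → ℕ} (h : ∀ j ∈ J, t j ≤ a j) : Cov T J q t M ℓ q a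
  | step {ℓ : ℕ} {p p' : Q} {x y a a' : ι → ℕ} (hT : T p x p' y) (hx : ∀ j, x j ≤ M)
      (hy : ∀ j, y j ≤ M) (hle : ∀ j ∈ J, x j ≤ a j) (heq : ∀ j ∈ J, a' j + x j = a j + y j)
      (h : Cov T J q t M ℓ p' a') : Cov T J q t M (ℓ + 1) p a

variable {T : Q → (ι → ℕ) → Q → (ι → ℕ) → Prop} {J : Finset ι} {q : Q} {t : ι → ℕ}

theorem Cov.mono {M M' ℓ ℓ' : ℕ} {p : Q} {a : ι → ℕ} (h : Cov T J q t M ℓ p a) (hM : M ≤ M')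
    (hℓ : ℓ ≤ ℓ') : Cov T J q t M' ℓ' p a := by
  induction h generalizing ℓ' with
  | done h => exact .done h
  | step hT hx hy hle heq _ ih =>
    obtain ⟨k, rfl⟩ : ∃ k, ℓ' = k + 1 := ⟨ℓ' - 1, by omega⟩
    exact .step hT (fun j => (hx j).trans hM) (fun j => (hy j).trans hM) hle heq (ih (by omega))

/-- A covering run also covers on coordinates that are large enough at the start. -/
theorem Cov.lift {J' : Finset ι} {M ℓ c : ℕ} {p : Q} {a b : ι → ℕ} (h : Cov T J' q t M ℓ p a)
    (hb : ∀ j ∈ J', b j = a j) (hJ : ∀ j ∈ J, j ∉ J' → ℓ * M + c ≤ b j)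
    (ht : ∀ j ∈ J, t j ≤ c) : Cov T J q t M ℓ p b := by
  induction h generalizing b with
  | done h =>
    refine .done fun j hj => ?_
    by_cases hj' : j ∈ J'
    · rw [hb j hj']; exact h j hj'
    · have := hJ j hj hj'
      have := ht j hj
      omega
  | @step ℓ p p' x y a a' hT hx hy hle heq _ ih =>
    have hxb : ∀ j ∈ J, x j ≤ b j := fun j hj => by
      by_cases hj' : j ∈ J'
      · rw [hb j hj']; exact hle j hj'
      · have := hJ j hj hj'
        have := hx j
        rw [add_mul] at *
        omega
    refine .step (a' := fun j => b j + y j - x j) hT hx hy hxb (fun j hj => ?_) (ih ?_ ?_)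
    · have := hxb j hj
      change b j + y j - x j + x j = _
      omega
    · intro j hj'
      have := heq j hj'
      have := hb j hj'
      omega
    · intro j hj hj'
      have := hJ j hj hj'
      have := hx j
      rw [add_mul] at *
      omega

theorem Cov.congr {M ℓ : ℕ} {p : Q} {a b : ι → ℕ} (h : Cov T J q t M ℓ p a)
    (hb : ∀ j ∈ J, b j = a j) : Cov T J q t M ℓ p b :=
  h.lift (c := ∑ j ∈ J, t j) hb (fun _ hj hj' => absurd hj hj') fun _ hj =>
    Finset.single_le_sum (fun _ _ => Nat.zero_le _) hj

theorem Cov.subset {J' : Finset ι} {M ℓ : ℕ} {p : Q} {a : ι → ℕ} (h : Cov T J q t M ℓ p a)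
    (hJ : J' ⊆ J) : Cov T J' q t M ℓ p a := by
  induction h with
  | done h => exact .done fun j hj => h j (hJ hj)
  | step hT hx hy hle heq _ ih =>
    exact .step hT hx hy (fun j hj => hle j (hJ hj)) (fun j hj => heq j (hJ hj)) ih

/-- Values above `c` can be lowered by one at a time, so every number in `(c, D x]` is a value of
`D`. All of them are attained on `S`, so there are at most `S.card` of them. -/
theorem rank_le {α : Type} (S : Finset α) (D : α → ℕ) (c : ℕ)
    (hS : ∀ x, c < D x → ∃ s ∈ S, D s = D x) (hD : ∀ x, c < D x → ∃ z, D z + 1 = D x) (x : α) :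
    D x ≤ c + S.card := by
  classical
  have key : ∀ k, k + c < D x → ∃ y, D y + k = D x := by
    intro k
    induction k with
    | zero => exact fun _ => ⟨x, rfl⟩
    | succ k ih =>
      intro h
      obtain ⟨y, hy⟩ := ih (by omega)
      obtain ⟨z, hz⟩ := hD y (by omega)
      exact ⟨z, by omega⟩
  have hsub : Finset.Ioc c (D x) ⊆ S.image D := by
    intro m hm
    rw [Finset.mem_Ioc] at hm
    obtain ⟨y, hy⟩ := key (D x - m) (by omega)
    obtain ⟨s, hs, h⟩ := hS y (by omega)
    exact Finset.mem_image.2 ⟨s, hs, by omega⟩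
  have := (Finset.card_le_card hsub).trans Finset.card_image_le
  rw [Nat.card_Ioc] at this
  omega

/-- Every transition has, for every threshold `B`, a variant with entries at most `h B` that agrees
with it up to the threshold. -/
def HasTruncations (T : Q → (ι → ℕ) → Q → (ι → ℕ) → Prop) (h : ℕ → ℕ) : Prop :=
  ∀ p x p' y, T p x p' y → ∀ B, ∃ z' : (ι → ℕ) × (ι → ℕ), T p z'.1 p' z'.2 ∧
    IsTruncation B (h B) (x, y) z'

variable {h : ℕ → ℕ} {c c₀ : ℕ}

section

variable (ht : ∀ j ∈ J, t j ≤ c₀)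
  (hc : ∀ J' ⊂ J, ∀ p a, (∃ M ℓ, Cov T J' q t M ℓ p a) → Cov T J' q t c c p a)
include ht hc

/-- Stop counting the coordinates that are at least `B`. The remaining coordinates are fewer, so `c`
steps with entries at most `c` suffice for them; such a run takes at most `c * c` from a dropped
coordinate and leaves at least `c₀`, which covers the target. -/
theorem cov_of_large {B : ℕ} (hB : c * c + c₀ ≤ B) {p : Q} {a : ι → ℕ} {j : ι} (hj : j ∈ J)
    (hja : B ≤ a j) (hcov : ∃ M ℓ, Cov T (J.filter fun j => a j < B) q t M ℓ p a) :
    Cov T J q t c c p a := by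
  refine (hc _ ?_ p a hcov).lift (fun _ _ => rfl) (fun j hj hj' => ?_) ht
  · refine (Finset.filter_ssubset).2 ⟨j, hj, by omega⟩
  · simp only [Finset.mem_filter, hj, true_and, not_lt] at hj'
    omega

/-- As long as all counted coordinates are below `B`, so are the counted source entries of the next
transition, and truncation keeps them. Counted target entries change only where they are at least
`B`; in that case a counter has become large and `cov_of_large` ends the run. -/
theorem cov_small_entries (hW : HasTruncations T h) {M ℓ : ℕ} {p : Q} {a : ι → ℕ}
    (hcov : Cov T J q t M ℓ p a) :
    ∃ ℓ', Cov T J q t (h (c * c + c₀) + c) ℓ' p a := by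
  set B := c * c + c₀ with hBdef
  have large : ∀ {p : Q} {a : ι → ℕ} {j : ι}, j ∈ J → B ≤ a j →
      (∃ M ℓ, Cov T (J.filter fun j => a j < B) q t M ℓ p a) →
      ∃ ℓ', Cov T J q t (h B + c) ℓ' p a := fun hj hja hcov =>
    ⟨c, (cov_of_large ht hc (le_of_eq hBdef.symm) hj hja hcov).mono (by omega) le_rfl⟩
  induction hcov with
  | done h => exact ⟨0, .done h⟩
  | @step ℓ p p' x y a a' hT hx hy hle heq hcov' ih =>
    by_cases hbig : ∃ j ∈ J, B ≤ a j
    · obtain ⟨j, hj, hja⟩ := hbig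
      exact large hj hja ⟨M, ℓ + 1, (Cov.step hT hx hy hle heq hcov').subset
        (Finset.filter_subset _ _)⟩
    · push Not at hbig
      obtain ⟨⟨x', y'⟩, hT', hx', hy'⟩ := hW p x p' y hT B
      have hxx : ∀ j ∈ J, x' j = x j := fun j hj =>
        (hx' j).1 ((hle j hj).trans_lt (hbig j hj))
      let b : ι → ℕ := fun j => a j + y' j - x' j
      have hb : ∀ j ∈ J, b j + x' j = a j + y' j := fun j hj => by
        have := hle j hj
        have := hxx j hj
        change a j + y' j - x' j + x' j = _
        omega
      have hsame : ∀ j ∈ J, y j < B → b j = a' j := fun j hj hlt => by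
        have := hb j hj
        have := heq j hj
        have := hxx j hj
        have := (hy' j).1 hlt
        simp only at this
        omega
      have hlarge : ∀ j ∈ J, B ≤ y j → B ≤ b j := fun j hj hge => by
        have := hb j hj
        have := hle j hj
        have := hxx j hj
        have := (hy' j).2.1 hge
        simp only at this
        omega
      obtain ⟨ℓ', hℓ'⟩ : ∃ ℓ', Cov T J q t (h B + c) ℓ' p' b := by
        by_cases hbig' : ∃ j ∈ J, B ≤ y j
        · obtain ⟨j, hj, hjy⟩ := hbig'
          -- On the coordinates where `b` is below `B` it equals `a'`, so the old continuation still
          -- covers there.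
          refine large hj (hlarge j hj hjy) ⟨M, ℓ, ?_⟩
          refine (hcov'.subset (Finset.filter_subset _ _)).congr fun i hi => ?_
          rw [Finset.mem_filter] at hi
          refine hsame i hi.1 ?_
          by_contra hge
          have := hlarge i hi.1 (by omega)
          omega
        · push Not at hbig'
          obtain ⟨ℓ', hℓ'⟩ := ih
          exact ⟨ℓ', hℓ'.congr fun j hj => hsame j hj (hbig' j hj)⟩
      exact ⟨ℓ' + 1, .step hT' (fun j => (hx' j).2.2.trans (Nat.le_add_right _ _))
        (fun j => (hy' j).2.2.trans (Nat.le_add_right _ _))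
        (fun j hj => (hxx j hj).le.trans (hle j hj)) hb hℓ'⟩

/-- Let `D` be the minimal number of steps with entries at most `h B + c`. If `D` exceeds `c`, then
no counted coordinate reaches `B`, since otherwise `cov_of_large` would finish in `c` steps. Up to
ignored coordinates, only the finitely many points of a box remain, and along a shortest run `D`
drops by exactly one per step. -/
theorem cov_short [Fintype Q] [Fintype ι] [DecidableEq ι] (h₀ : 0 < c₀)
    (hW : HasTruncations T h) {p : Q}
    {a : ι → ℕ} (hcov : ∃ M ℓ, Cov T J q t M ℓ p a) :
    Cov T J q t (h (c * c + c₀) + c)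
      (c + Fintype.card Q * (c * c + c₀) ^ Fintype.card ι) p a := by
  classical
  set B := c * c + c₀ with hBdef
  set M₀ := h B + c
  let D : Q × (ι → ℕ) → ℕ := fun s => sInf {ℓ | Cov T J q t M₀ ℓ s.1 s.2}
  have hDle : ∀ {ℓ s}, Cov T J q t M₀ ℓ s.1 s.2 → D s ≤ ℓ := fun h => Nat.sInf_le h
  have hDmem : ∀ s, (∃ ℓ, Cov T J q t M₀ ℓ s.1 s.2) → Cov T J q t M₀ (D s) s.1 s.2 :=
    fun s h => Nat.sInf_mem h
  -- The infimum of the empty set is 0, so a positive value of `D` certifies that a covering run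
  -- exists.
  have hDmem' : ∀ s, 0 < D s → Cov T J q t M₀ (D s) s.1 s.2 := fun s hs =>
    Nat.sInf_mem (Nat.nonempty_of_pos_sInf hs)
  obtain ⟨M, ℓ, hcov⟩ := hcov
  have hfin := hDmem (p, a) (cov_small_entries ht hc hW hcov)
  refine hfin.mono le_rfl ((rank_le (Finset.univ ×ˢ Fintype.piFinset fun _ => Finset.range B) D c
    (fun s hs => ?_) (fun s hs => ?_) (p, a)).trans (by simp))
  · have hs' := hDmem' s (by omega)
    have hbox : ∀ j ∈ J, s.2 j < B := by
      by_contra! hbig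
      obtain ⟨j, hj, hja⟩ := hbig
      have h1 := cov_of_large ht hc (le_of_eq hBdef.symm) hj hja
        ⟨_, _, hs'.subset (Finset.filter_subset _ _)⟩
      have := hDle (h1.mono (M' := M₀) (Nat.le_add_left _ _) le_rfl)
      omega
    -- `D` depends on the counted coordinates only. Setting the others to 0 moves the point into the
    -- box; this needs `0 < B`, which comes from `0 < c₀`.
    refine ⟨(s.1, fun j => if j ∈ J then s.2 j else 0), ?_, ?_⟩
    · simp only [Finset.mem_product, Finset.mem_univ, true_and, Fintype.mem_piFinset,
        Finset.mem_range]
      intro j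
      split_ifs with hj
      · exact hbox j hj
      · omega
    · change sInf _ = sInf _
      congr 1
      ext ℓ
      exact ⟨fun h => h.congr fun j hj => by simp [hj], fun h => h.congr fun j hj => by simp [hj]⟩
  · have hs' := hDmem' s (by omega)
    obtain ⟨p, a⟩ := s
    generalize hd : D (p, a) = d at hs' hs
    cases hs' with
    | done h => exact absurd (hDle (s := (p, a)) (ℓ := 0) (.done h)) (by omega)
    | @step ℓ _ p' x y _ a' hT hx hy hle heq h' =>
      -- The second configuration of a shortest covering run has distance exactly one less.
      refine ⟨(p', a'), ?_⟩
      have h1 : D (p', a') ≤ ℓ := hDle (s := (p', a')) h'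
      have h2 : D (p, a) ≤ D (p', a') + 1 :=
        hDle (s := (p, a)) (.step hT hx hy hle heq (hDmem (p', a') ⟨ℓ, h'⟩))
      omega

end

/-- Rackoff's induction on the counted coordinates: a bound for all proper subsets of `J` becomes a
bound for `J` by one application of `Φ`, which dominates both the entries and the length in
`cov_short`. -/
theorem cov_bounded [Fintype Q] [Fintype ι] [DecidableEq ι] (h₀ : 0 < c₀)
    (hW : HasTruncations T h) {Φ : ℕ → ℕ} (hΦ : ∀ c, c ≤ Φ c)
    (h1 : ∀ c, c₀ ≤ c → h (c * c + c₀) + c ≤ Φ c)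
    (h2 : ∀ c, c₀ ≤ c → c + Fintype.card Q * (c * c + c₀) ^ Fintype.card ι ≤ Φ c)
    (J : Finset ι) (ht : ∀ j ∈ J, t j ≤ c₀) {p : Q} {a : ι → ℕ}
    (hcov : ∃ M ℓ, Cov T J q t M ℓ p a) :
    Cov T J q t (Φ^[J.card + 1] c₀) (Φ^[J.card + 1] c₀) p a := by
  have hle : ∀ {k l}, k ≤ l → Φ^[k] c₀ ≤ Φ^[l] c₀ := fun {k l} hkl =>
    monotone_nat_of_le_succ (f := fun k => Φ^[k] c₀)
      (fun k => by simp only [Function.iterate_succ_apply']; exact hΦ _) hkl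
  induction J using Finset.strongInduction generalizing p a with
  | H J ih =>
    rw [Function.iterate_succ_apply']
    have hc₀ : c₀ ≤ Φ^[J.card] c₀ := hle (Nat.zero_le J.card)
    refine (cov_short (c := Φ^[J.card] c₀) ht (fun J' hJ' p a hcov => ?_) h₀ hW hcov).mono
      (h1 _ hc₀) (h2 _ hc₀)
    have := hle (Finset.card_lt_card hJ')
    exact (ih J' hJ' (fun j hj => ht j (hJ'.1 hj)) hcov).mono this this

end Cover

/-! ### Euler walks in strongly connected directed multigraphs -/

section Euler

variable {Q E : Type} (src tgt : E → Q)

/-- The list of edges `l` is a walk from `s` to `t`. -/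
def IsWalk : Q → List E → Q → Prop
  | s, [], t => s = t
  | s, e :: l, t => src e = s ∧ IsWalk (tgt e) l t

variable {src tgt}

theorem isWalk_append {s t : Q} {l₁ l₂ : List E} :
    IsWalk src tgt s (l₁ ++ l₂) t ↔ ∃ q, IsWalk src tgt s l₁ q ∧ IsWalk src tgt q l₂ t := by
  induction l₁ generalizing s with
  | nil => simp [IsWalk]
  | cons e l₁ ih => simp [IsWalk, ih, and_assoc]

variable [Fintype E] [DecidableEq E] [DecidableEq Q]

variable (src tgt) in
/-- The flow into `q` minus the flow out of `q`. -/
def netFlow (u : E → ℤ) (q : Q) : ℤ :=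
  ∑ e with tgt e = q, u e - ∑ e with src e = q, u e

omit [DecidableEq E] in
theorem netFlow_add (u v : E → ℤ) : netFlow src tgt (u + v) = netFlow src tgt u + netFlow src tgt v := by
  ext q
  simp only [netFlow, Pi.add_apply, Finset.sum_add_distrib]
  ring

omit [DecidableEq E] in
theorem netFlow_sub (u v : E → ℤ) : netFlow src tgt (u - v) = netFlow src tgt u - netFlow src tgt v := by
  ext q
  simp only [netFlow, Pi.sub_apply, Finset.sum_sub_distrib]
  ring

omit [DecidableEq E] in
theorem netFlow_smul (c : ℤ) (u : E → ℤ) : netFlow src tgt (c • u) = c • netFlow src tgt u := by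
  ext q
  simp only [netFlow, Pi.smul_apply, smul_eq_mul, ← Finset.mul_sum]
  ring

theorem netFlow_single (e : E) :
    netFlow src tgt (Pi.single e 1) = Pi.single (tgt e) 1 - Pi.single (src e) 1 := by
  ext q
  simp [netFlow, Pi.single_apply, eq_comm]

theorem netFlow_count {s t : Q} {l : List E} (h : IsWalk src tgt s l t) :
    netFlow src tgt (fun e => (l.count e : ℤ)) = Pi.single t 1 - Pi.single s 1 := by
  induction l generalizing s with
  | nil =>
    obtain rfl : s = t := h
    ext q
    simp [netFlow]
  | cons e l ih =>
    obtain ⟨rfl, h⟩ := h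
    have h1 : (fun e' => ((e :: l).count e' : ℤ)) = (fun e' => (l.count e' : ℤ)) + Pi.single e 1 := by
      ext e'
      by_cases h : e = e'
      · subst h; simp
      · simp [h, Ne.symm h]
    rw [h1, netFlow_add, ih h, netFlow_single]
    abel

/-- If `s ≠ t`, the deficit at `s` forces an outgoing edge with positive `u`. Removing one copy of
it leaves a flow from its target to `t` of smaller total. -/
theorem exists_walk_le {s t : Q} (u : E → ℕ)
    (hu : netFlow src tgt (fun e => (u e : ℤ)) = Pi.single t 1 - Pi.single s 1) :
    ∃ l, IsWalk src tgt s l t ∧ ∀ e, l.count e ≤ u e := by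
  induction hn : ∑ e, u e generalizing s u with
  | zero =>
    refine ⟨[], ?_, by simp⟩
    have h0 : ∀ e, u e = 0 := fun e => (Finset.sum_eq_zero_iff.1 hn) e (Finset.mem_univ e)
    have := congrFun hu t
    simp only [netFlow, h0, Nat.cast_zero, Finset.sum_const_zero, sub_self, Pi.sub_apply,
      Pi.single_eq_same] at this
    by_contra hst
    change s ≠ t at hst
    simp [hst.symm] at this
  | succ n ih =>
    by_cases hst : s = t
    · exact ⟨[], hst, by simp⟩
    have hs := congrFun hu s
    have hex : ∃ e, src e = s ∧ 0 < u e := by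
      by_contra! hno
      have h0 : ∑ e with src e = s, (u e : ℤ) = 0 := Finset.sum_eq_zero fun e he => by
        have := hno e (Finset.mem_filter.1 he).2
        exact_mod_cast Nat.le_zero.1 this
      have h1 : 0 ≤ ∑ e with tgt e = s, (u e : ℤ) := Finset.sum_nonneg fun _ _ => by positivity
      simp only [netFlow, h0, Pi.sub_apply, Pi.single_apply, hst, if_true, if_false] at hs
      omega
    obtain ⟨e, rfl, he⟩ := hex
    have hcast : (fun e' => ((u - Pi.single e 1 : E → ℕ) e' : ℤ)) =
        (fun e' => (u e' : ℤ)) - Pi.single e 1 := by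
      ext e'
      rcases eq_or_ne e' e with rfl | h
      · simp; omega
      · simp [h]
    have hsum : ∑ e', (u - Pi.single e 1 : E → ℕ) e' = n := by
      have : ∑ e', u e' = ∑ e', (u - Pi.single e 1 : E → ℕ) e' + ∑ e', (Pi.single e 1 : E → ℕ) e' := by
        rw [← Finset.sum_add_distrib]
        refine Finset.sum_congr rfl fun e' _ => ?_
        rcases eq_or_ne e' e with rfl | h
        · simp; omega
        · simp [h]
      simp at this
      simp
      omega
    obtain ⟨l, hl, hle⟩ := ih (s := tgt e) (u - Pi.single e 1)
      (by rw [hcast, netFlow_sub, hu, netFlow_single]; abel) hsum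
    refine ⟨e :: l, ⟨rfl, hl⟩, fun e' => ?_⟩
    have := hle e'
    rcases eq_or_ne e' e with rfl | h
    · simp at this ⊢; omega
    · simpa [h, Ne.symm h] using this

/-- Extend a walk below `u` by splicing in closed walks until every edge is used `u e` times; the
measure is the number of missing uses. -/
theorem exists_euler_walk
    (hconn : ∀ p q : Q, Relation.ReflTransGen (fun p q => ∃ e, src e = p ∧ tgt e = q) p q)
    {s t : Q} (u : E → ℕ) (hu1 : ∀ e, 1 ≤ u e)
    (hu : netFlow src tgt (fun e => (u e : ℤ)) = Pi.single t 1 - Pi.single s 1) :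
    ∃ l, IsWalk src tgt s l t ∧ ∀ e, l.count e = u e := by
  have key : ∀ n l, IsWalk src tgt s l t → (∀ e, l.count e ≤ u e) → ∑ e, (u e - l.count e) = n →
      ∃ l, IsWalk src tgt s l t ∧ ∀ e, l.count e = u e := by
    intro n
    induction n using Nat.strong_induction_on with
    | _ n ih =>
    intro l hl hle hn
    by_cases hall : ∀ e, l.count e = u e
    · exact ⟨l, hl, hall⟩
    push Not at hall
    obtain ⟨e₀, he₀⟩ := hall
    let visited : Q → Prop := fun q => ∃ l₁ l₂, l = l₁ ++ l₂ ∧ IsWalk src tgt s l₁ q ∧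
      IsWalk src tgt q l₂ t
    -- Otherwise every edge that leaves a visited state has all its uses, at least one, on the walk,
    -- so the visited states are closed under successors. Strong connectivity then makes all states
    -- visited, including the source of the unfinished edge `e₀`.
    have hex : ∃ e, l.count e < u e ∧ visited (src e) := by
      by_contra! hno
      have hstep : ∀ f, visited (src f) → visited (tgt f) := by
        intro f hf
        have hmem : f ∈ l := by
          by_contra hmem
          refine hno f ?_ hf
          rw [List.count_eq_zero_of_not_mem hmem]
          exact hu1 f
        obtain ⟨l₁, l₂, rfl⟩ := List.append_of_mem hmem
        obtain ⟨q, h1, rfl, h2⟩ := isWalk_append.1 hl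
        exact ⟨l₁ ++ [f], l₂, by simp, isWalk_append.2 ⟨_, h1, rfl, rfl⟩, h2⟩
      have hvis : ∀ q, visited q := fun q => by
        induction hconn s q with
        | refl => exact ⟨[], l, rfl, rfl, hl⟩
        | tail _ h ih =>
          obtain ⟨f, rfl, rfl⟩ := h
          exact hstep f ih
      exact hno e₀ (lt_of_le_of_ne (hle e₀) he₀) (hvis _)
    obtain ⟨e, he, l₁, l₂, rfl, h1, h2⟩ := hex
    have hcast : (fun e' => ((u e' - (l₁ ++ l₂).count e' - (Pi.single e 1 : E → ℕ) e' : ℕ) : ℤ)) =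
        (fun e' => (u e' : ℤ)) - (fun e' => ((l₁ ++ l₂).count e' : ℤ)) - Pi.single e 1 := by
      ext e'
      have := hle e'
      rcases eq_or_ne e' e with rfl | h
      · simp only [Pi.sub_apply, Pi.single_eq_same]; omega
      · simp only [Pi.sub_apply, Pi.single_eq_of_ne h]; omega
    -- What is left of `u` after the walk is a circulation; without one copy of `e` it is a flow
    -- from the target of `e` back to its source. Together with `e` the walk `l'` closes up and can
    -- be inserted at the visited state.
    obtain ⟨l', hl', hle'⟩ := exists_walk_le (s := tgt e) (t := src e)
      (fun e' => u e' - (l₁ ++ l₂).count e' - (Pi.single e 1 : E → ℕ) e')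
      (by rw [hcast, netFlow_sub, netFlow_sub, netFlow_single, hu, netFlow_count hl]; abel)
    have hcount : ∀ e', (l₁ ++ e :: l' ++ l₂).count e' =
        (l₁ ++ l₂).count e' + l'.count e' + (Pi.single e 1 : E → ℕ) e' := fun e' => by
      rcases eq_or_ne e' e with rfl | h
      · simp; ring
      · simp [h, Ne.symm h]; ring
    have hle'' : ∀ e', (l₁ ++ l₂).count e' + l'.count e' + (Pi.single e 1 : E → ℕ) e' ≤ u e' := by
      intro e'
      have := hle e'
      have := hle' e'
      rcases eq_or_ne e' e with rfl | h
      · simp only [Pi.single_eq_same] at *; omega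
      · simp only [Pi.single_eq_of_ne h] at *; omega
    refine ih _ ?_ (l₁ ++ e :: l' ++ l₂) ?_ (fun e' => (hcount e').trans_le (hle'' e')) rfl
    · rw [← hn]
      refine Finset.sum_lt_sum (fun e' _ => ?_) ⟨e, Finset.mem_univ e, ?_⟩
      · rw [hcount]; omega
      · rw [hcount, Pi.single_eq_same]; omega
    · exact isWalk_append.2 ⟨_, isWalk_append.2 ⟨_, h1, rfl, hl'⟩, h2⟩
  obtain ⟨l, hl, hle⟩ := exists_walk_le u hu
  exact key _ l hl hle rfl

end Euler

theorem effect_add {n : ℕ} (z z' : Pair n n) : effect (z + z') = effect z + effect z' := by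
  ext j; simp [effect]; ring

theorem effect_diag {n : ℕ} (a : Vec n) : effect (a, a) = 0 := by
  ext j; simp [effect]

theorem effect_nsmul {n : ℕ} (k : ℕ) (z : Pair n n) : effect (k • z) = (k : ℤ) • effect z := by
  ext j; simp [effect]; ring

theorem effect_sum {n : ℕ} {β : Type} (s : Finset β) (f : β → Pair n n) :
    effect (∑ b ∈ s, f b) = ∑ b ∈ s, effect (f b) := by
  classical
  induction s using Finset.induction_on with
  | empty => exact effect_diag 0
  | insert b s hb ih => rw [Finset.sum_insert hb, Finset.sum_insert hb, effect_add, ih]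

theorem MonotoneRel.add_mem {n : ℕ} {R : Set (Pair n n)} (h : MonotoneRel R) {x y : Vec n}
    (hz : (x, y) ∈ R) (a : Vec n) : (x + a, y + a) ∈ R := by
  obtain ⟨_, h⟩ := h
  exact h _ hz a

/-! ### Runs with prescribed uses of edges and periods -/

namespace MEVASS

variable {C : RelClass} (V : MEVASS C) (i : Fin (V.k + 1))

/-- There is a run from `p(x)` to `q(y)` in the `i`-th component that uses the edges as often as
given by `u`, and their periods as often as given by `v`. -/
inductive HasRun : V.State i → Vec (V.n i) → V.State i → Vec (V.n i) → (V.Edge i → ℕ) →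
    (V.Edge i → Pair (V.n i) (V.n i) → ℕ) → Prop
  | nil (q : V.State i) (x : Vec (V.n i)) : HasRun q x q x 0 0
  | cons (e : V.Edge i) (x y a : Vec (V.n i)) (c : Pair (V.n i) (V.n i) → ℕ)
      (mem : (x, y) ∈ (V.label i e).set)
      (decomp : (x, y) = V.base i e + ∑ p ∈ V.periods i e, c p • p + (a, a))
      {q : V.State i} {z : Vec (V.n i)} {u : V.Edge i → ℕ}
      {v : V.Edge i → Pair (V.n i) (V.n i) → ℕ} (rest : HasRun (V.tgt i e) y q z u v) :
      HasRun (V.src i e) x q z (Pi.single e 1 + u) (Pi.single e c + v)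

/-- The element of `L(e)` with the given numbers of uses of the periods. -/
def point (e : V.Edge i) (c : Pair (V.n i) (V.n i) → ℕ) : Pair (V.n i) (V.n i) :=
  V.base i e + ∑ p ∈ V.periods i e, c p • p

/-- The effect of a run with the given numbers of uses of edges and periods. -/
def totalEffect (u : V.Edge i → ℤ) (v : V.Edge i → Pair (V.n i) (V.n i) → ℤ) : Fin (V.n i) → ℤ :=
  ∑ e : V.Edge i, (u e • effect (V.base i e) + ∑ p ∈ V.periods i e, v e p • effect p)

variable {V i}

theorem totalEffect_add (u u' : V.Edge i → ℤ) (v v' : V.Edge i → Pair (V.n i) (V.n i) → ℤ) :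
    V.totalEffect i (u + u') (v + v') = V.totalEffect i u v + V.totalEffect i u' v' := by
  simp only [totalEffect, ← Finset.sum_add_distrib]
  refine Finset.sum_congr rfl fun e _ => ?_
  simp only [Pi.add_apply, add_smul, Finset.sum_add_distrib]
  abel

theorem totalEffect_smul (c : ℤ) (u : V.Edge i → ℤ) (v : V.Edge i → Pair (V.n i) (V.n i) → ℤ) :
    V.totalEffect i (c • u) (c • v) = c • V.totalEffect i u v := by
  simp only [totalEffect, Finset.smul_sum, smul_add, Pi.smul_apply, smul_assoc]

theorem totalEffect_congr {u u' : V.Edge i → ℤ} {v v' : V.Edge i → Pair (V.n i) (V.n i) → ℤ}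
    (hu : ∀ e, u e = u' e) (hv : ∀ e, ∀ p ∈ V.periods i e, v e p = v' e p) :
    V.totalEffect i u v = V.totalEffect i u' v' := by
  simp only [totalEffect, hu]
  exact Finset.sum_congr rfl fun e _ => by rw [Finset.sum_congr rfl fun p hp => by rw [hv e p hp]]

namespace HasRun

variable {p q r : V.State i} {x y z : Vec (V.n i)} {u u' : V.Edge i → ℕ}
  {v v' : V.Edge i → Pair (V.n i) (V.n i) → ℕ}

theorem append (h : V.HasRun i p x q y u v) (h' : V.HasRun i q y r z u' v') :
    V.HasRun i p x r z (u + u') (v + v') := by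
  induction h with
  | nil => simpa using h'
  | cons e x y a c mem decomp _ ih =>
    rw [add_assoc, add_assoc]
    exact .cons e x y a c mem decomp (ih h')

theorem add (h : V.HasRun i p x q y u v) (b : Vec (V.n i)) :
    V.HasRun i p (x + b) q (y + b) u v := by
  induction h with
  | nil q x => exact .nil q _
  | cons e x y a c mem decomp _ ih =>
    refine .cons e (x + b) (y + b) (a + b) c ((V.monotone i e).add_mem mem b) ?_ ih
    have h : ((x + b, y + b) : Pair (V.n i) (V.n i)) = (x, y) + (b, b) := rfl
    have h' : ((a + b, a + b) : Pair (V.n i) (V.n i)) = (a, a) + (b, b) := rfl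
    rw [h, h', decomp, add_assoc _ (a, a)]

theorem of_le (h : V.HasRun i p x q y u v) {x' : Vec (V.n i)} (hx : x ≤ x') :
    ∃ y', V.HasRun i p x' q y' u v ∧ ∀ j, y' j + x j = x' j + y j := by
  refine ⟨y + (x' - x), ?_, fun j => ?_⟩
  · have := h.add (x' - x)
    rwa [add_tsub_cancel_of_le hx] at this
  · have : x j ≤ x' j := hx j
    simp only [Pi.add_apply, Pi.sub_apply]
    omega

theorem effect_eq (h : V.HasRun i p x q y u v) :
    effect (x, y) = V.totalEffect i (fun e => u e) (fun e p => v e p) := by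
  induction h with
  | nil q x => rw [effect_diag]; simp [totalEffect]
  | @cons e x y a c mem decomp q z u v _ ih =>
    have h1 : effect (x, z) = effect (x, y) + effect (y, z) := by
      ext j; simp [effect]
    have h2 : effect (x, y) = effect (V.base i e) + ∑ p ∈ V.periods i e, (c p : ℤ) • effect p := by
      rw [decomp, effect_add, effect_diag, add_zero, effect_add, effect_sum]
      simp only [effect_nsmul]
    rw [h1, ih, h2]
    have h3 : V.totalEffect i (Pi.single e 1) (Pi.single e fun p => (c p : ℤ)) =
        effect (V.base i e) + ∑ p ∈ V.periods i e, (c p : ℤ) • effect p := by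
      rw [totalEffect, Finset.sum_eq_single e]
      · simp
      · intro e' _ he'
        simp [he']
      · simp
    rw [← h3, ← totalEffect_add]
    refine totalEffect_congr (fun e' => ?_) fun e' p _ => ?_
    · rcases eq_or_ne e' e with rfl | h <;> simp [*]
    · rcases eq_or_ne e' e with rfl | h <;> simp [*]

theorem netFlow_eq (h : V.HasRun i p x q y u v) :
    netFlow (V.src i) (V.tgt i) (fun e => (u e : ℤ)) = Pi.single q 1 - Pi.single p 1 := by
  induction h with
  | nil q x => ext; simp [netFlow]
  | @cons e x y a c mem decomp q z u v _ ih =>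
    have : (fun e' => ((Pi.single e 1 + u : V.Edge i → ℕ) e' : ℤ)) =
        Pi.single e 1 + fun e' => (u e' : ℤ) := by
      ext e'
      rcases eq_or_ne e' e with rfl | h <;> simp [*]
    rw [this, netFlow_add, netFlow_single, ih]
    abel

theorem exists_componentRun (h : V.HasRun i p x q y u v) :
    ∃ r : V.ComponentRun i p x q y, (∀ e, r.edgeCount e = u e) ∧
      ∀ e p, r.periodCount e p = v e p := by
  induction h with
  | nil q x => exact ⟨.nil q x, fun _ => rfl, fun _ _ => rfl⟩
  | cons e x y a c mem decomp _ ih =>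
    obtain ⟨r, h1, h2⟩ := ih
    refine ⟨.cons e x y a c mem decomp r, fun e' => ?_, fun e' p => ?_⟩
    · rcases eq_or_ne e e' with rfl | h <;> simp [ComponentRun.edgeCount, *]
    · rcases eq_or_ne e e' with rfl | h <;> simp [ComponentRun.periodCount, *, Ne.symm]

/-- By monotonicity the loop can be executed from every configuration above `x`, always with the
same effect, so only the configuration before each repetition has to be compared with `x`. -/
theorem iterate (h : V.HasRun i q x q y u v) {x' : Vec (V.n i)} (t : ℕ)
    (hle : ∀ s < t, ∀ j, (x j : ℤ) ≤ x' j + s * ((y j : ℤ) - x j)) :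
    ∃ y', V.HasRun i q x' q y' (t • u) (t • v) ∧ ∀ j, (y' j : ℤ) = x' j + t * ((y j : ℤ) - x j) := by
  induction t with
  | zero => exact ⟨x', by simpa using .nil q x', by simp⟩
  | succ t ih =>
    obtain ⟨y₁, h₁, e₁⟩ := ih fun s hs => hle s (by omega)
    obtain ⟨y₂, h₂, e₂⟩ := h.of_le (x' := y₁) fun j => by
      have := hle t (by omega) j
      rw [← e₁] at this
      exact_mod_cast this
    refine ⟨y₂, ?_, fun j => ?_⟩
    · rw [succ_nsmul, succ_nsmul]
      exact h₁.append h₂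
    · have := e₁ j
      have := e₂ j
      push_cast
      linarith

theorem of_point (e : V.Edge i) (c : Pair (V.n i) (V.n i) → ℕ)
    (hc : V.point i e c ∈ (V.label i e).set) (hx : (V.point i e c).1 ≤ x) :
    ∃ y, (x ≤ y + (V.point i e c).1) ∧ ∀ {q z u v}, V.HasRun i (V.tgt i e) y q z u v →
      V.HasRun i (V.src i e) x q z (Pi.single e 1 + u) (Pi.single e c + v) := by
  refine ⟨(V.point i e c).2 + (x - (V.point i e c).1), fun j => ?_, fun h =>
    .cons e x _ (x - (V.point i e c).1) c ?_ ?_ h⟩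
  · simp only [Pi.add_apply, Pi.sub_apply]
    omega
  · have h' : (V.point i e c).1 + (x - (V.point i e c).1) = x := add_tsub_cancel_of_le hx
    have := (V.monotone i e).add_mem (show ((V.point i e c).1, (V.point i e c).2) ∈ _ from hc)
      (x - (V.point i e c).1)
    rwa [h'] at this
  · ext1
    · exact (add_tsub_cancel_of_le hx).symm
    · rfl

/-- A walk can be executed so that the last use of every edge carries all periods. -/
theorem of_walk {s t : V.State i} {l : List (V.Edge i)} (hl : IsWalk (V.src i) (V.tgt i) s l t)
    (v : V.Edge i → Pair (V.n i) (V.n i) → ℕ) (hbase : ∀ e, V.base i e ∈ (V.label i e).set)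
    (hfull : ∀ e, V.point i e (v e) ∈ (V.label i e).set) {K : ℕ}
    (hK : ∀ e j, (V.point i e (v e)).1 j ≤ K) (hx : ∀ j, l.length * K ≤ x j) :
    ∃ y, V.HasRun i s x t y (fun e => l.count e) (fun e => if e ∈ l then v e else 0) := by
  induction l generalizing s x with
  | nil =>
    obtain rfl : s = t := hl
    refine ⟨x, ?_⟩
    convert HasRun.nil s x using 1
    · ext; simp
    · ext; simp
  | cons e l ih =>
    obtain ⟨rfl, hl⟩ := hl
    -- If the edge occurs again later, this use is the base alone and the periods are left to the
    -- last occurrence.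
    let c : Pair (V.n i) (V.n i) → ℕ := if e ∈ l then 0 else v e
    have hp : V.point i e c ∈ (V.label i e).set ∧ ∀ j, (V.point i e c).1 j ≤ K := by
      by_cases he : e ∈ l
      · have h0 : V.point i e c = V.base i e := by simp [point, c, he]
        refine ⟨h0 ▸ hbase e, fun j => ?_⟩
        rw [h0]
        refine le_trans ?_ (hK e j)
        simp [point]
      · simp only [c, he, if_false]
        exact ⟨hfull e, hK e⟩
    obtain ⟨y, hy, hrun⟩ := of_point (x := x) e c hp.1 fun j => by
      have h1 := hx j
      rw [List.length_cons, add_mul, one_mul] at h1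
      exact (hp.2 j).trans ((Nat.le_add_left _ _).trans h1)
    obtain ⟨z, hz⟩ := ih hl (x := y) fun j => by
      have h1 := hx j
      have h2 := hp.2 j
      have h3 : x j ≤ y j + (V.point i e c).1 j := hy j
      rw [List.length_cons, add_mul, one_mul] at h1
      generalize (V.point i e c).1 j = k at *
      omega
    refine ⟨z, ?_⟩
    convert hrun hz using 1
    · ext e'
      rcases eq_or_ne e' e with rfl | h
      · simp [add_comm]
      · simp [h, Ne.symm h]
    · ext e' p
      rcases eq_or_ne e' e with rfl | h
      · by_cases he : e' ∈ l <;> simp [c, he]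
      · simp [h]

end HasRun

end MEVASS

/-! ### Pumping in a single component -/

namespace MEVASS

variable {C : RelClass} {V : MEVASS C} {i : Fin (V.k + 1)}

namespace HasRun

/-- Euler walks can be executed on large counters. -/
theorem of_euler {s t : V.State i} (u : V.Edge i → ℕ)
    (v : V.Edge i → Pair (V.n i) (V.n i) → ℕ) (hu1 : ∀ e, 1 ≤ u e)
    (hu : netFlow (V.src i) (V.tgt i) (fun e => (u e : ℤ)) = Pi.single t 1 - Pi.single s 1)
    (hbase : ∀ e, V.base i e ∈ (V.label i e).set)
    (hfull : ∀ e, V.point i e (v e) ∈ (V.label i e).set) {K L : ℕ}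
    (hK : ∀ e j, (V.point i e (v e)).1 j ≤ K) (hL : ∑ e, u e ≤ L) {x : Vec (V.n i)}
    (hx : ∀ j, L * K ≤ x j) : ∃ y, V.HasRun i s x t y u v := by
  obtain ⟨l, hl, hc⟩ := exists_euler_walk (V.stronglyConnected i) u hu1 hu
  have hlen : l.length = ∑ e, u e := by
    have := Multiset.sum_count_eq_card (s := Finset.univ) (m := (l : Multiset (V.Edge i))) (by simp)
    simp only [Multiset.coe_count, Multiset.coe_card] at this
    rw [← this]
    exact Finset.sum_congr rfl fun e _ => hc e
  obtain ⟨y, hy⟩ := of_walk hl v hbase hfull hK (x := x) fun j =>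
    (Nat.mul_le_mul_right K (hlen.trans_le hL)).trans (hx j)
  refine ⟨y, ?_⟩
  convert hy using 1
  · ext e; exact (hc e).symm
  · ext e p
    have : e ∈ l := List.count_pos_iff.1 (by rw [hc]; exact hu1 e)
    simp [this]

theorem effect_apply {p q : V.State i} {x y : Vec (V.n i)} {u : V.Edge i → ℕ}
    {v : V.Edge i → Pair (V.n i) (V.n i) → ℕ} (h : V.HasRun i p x q y u v) (j : Fin (V.n i)) :
    (y j : ℤ) = x j + V.totalEffect i (fun e => u e) (fun e p => v e p) j := by
  have := congrFun h.effect_eq j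
  simp only [effect] at this
  linarith

end HasRun

open HasRun in
/-- Lambert's pumping argument in a single component. -/
theorem exists_hasRun_add_mul
    {X Y wX wY a₁ a₂ b₁ b₂ : Vec (V.n i)} {ux uw u₁ u₂ : V.Edge i → ℕ}
    {vx vw v₁ v₂ : V.Edge i → Pair (V.n i) (V.n i) → ℕ}
    (hbase : ∀ e, V.base i e ∈ (V.label i e).set)
    (hx_flow : netFlow (V.src i) (V.tgt i) (fun e => (ux e : ℤ)) =
      Pi.single (V.qfin i) 1 - Pi.single (V.qin i) 1)
    (hx_eff : ∀ j, (Y j : ℤ) - X j = V.totalEffect i (fun e => ux e) (fun e p => vx e p) j)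
    (hw_flow : netFlow (V.src i) (V.tgt i) (fun e => (uw e : ℤ)) = 0)
    (hw_eff : ∀ j, (wY j : ℤ) - wX j = V.totalEffect i (fun e => uw e) (fun e p => vw e p) j)
    (huw : ∀ e, 1 ≤ uw e)
    (hup : V.HasRun i (V.qin i) a₁ (V.qin i) a₂ u₁ v₁)
    (ha : ∀ j, wX j = 0 → a₁ j = X j ∧ X j + 1 ≤ a₂ j)
    (hdown : V.HasRun i (V.qfin i) b₁ (V.qfin i) b₂ u₂ v₂)
    (hb : ∀ j, wY j = 0 → b₂ j = Y j ∧ Y j + 1 ≤ b₁ j)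
    {M r t K L : ℕ} (hMu : ∀ e, u₁ e + u₂ e + 1 ≤ M * uw e)
    (hMv : ∀ e, ∀ p ∈ V.periods i e, v₁ e p + v₂ e p ≤ M * vw e p)
    (hMa : ∀ j, wX j ≠ 0 → 2 * a₁ j + a₂ j + 1 ≤ M * wX j)
    (hMb : ∀ j, wY j ≠ 0 → 2 * b₁ j + b₂ j + 1 ≤ M * wY j)
    (hcycle : ∀ e, V.point i e (fun p => M * vw e p - v₁ e p - v₂ e p) ∈ (V.label i e).set)
    (hpath : ∀ e, V.point i e (fun p => vx e p + r * vw e p) ∈ (V.label i e).set)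
    (hr : 1 ≤ r)
    (hK₁ : ∀ e j, (V.point i e (fun p => M * vw e p - v₁ e p - v₂ e p)).1 j ≤ K)
    (hK₂ : ∀ e j, (V.point i e (fun p => vx e p + r * vw e p)).1 j ≤ K)
    (hL₁ : ∑ e, (M * uw e - u₁ e - u₂ e) ≤ L) (hL₂ : ∑ e, (ux e + r * uw e) ≤ L)
    (ht : L * K ≤ t) :
    ∃ v, V.HasRun i (V.qin i) (X + (r + t * M) • wX) (V.qfin i) (Y + (r + t * M) • wY)
      (ux + (r + t * M) • uw) v ∧
      ∀ e, ∀ p ∈ V.periods i e, v e p = vx e p + (r + t * M) * vw e p := by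
  -- The run consists of `t` upward loops, the path, `t` cycles and `t` downward loops. The uses of
  -- the loops are subtracted in the cycle, so one round of loop, cycle and loop uses exactly `M •
  -- w`, and the whole run uses `x + (r + t * M) • w`.
  set m := r + t * M with hm
  -- pumping up
  obtain ⟨z₁, hrun₁, hz₁⟩ := hup.iterate (x' := X + m • wX) t fun s hs j => by
    simp only [Pi.add_apply, Pi.smul_apply, smul_eq_mul, Nat.cast_add, Nat.cast_mul, hm]
    -- Where `wX` vanishes, the loop starts from exactly `X` and increases the counter. Elsewhere
    -- the surplus `t * M * wX` pays for all `t` repetitions.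
    by_cases h0 : wX j = 0
    · obtain ⟨h1, h2⟩ := ha j h0
      rw [h0, h1]
      have h3 : (0 : ℤ) ≤ s * ((a₂ j : ℤ) - X j) := mul_nonneg (by positivity) (by omega)
      push_cast at *
      linarith
    · have h1 : (2 * a₁ j + a₂ j + 1 : ℤ) ≤ M * wX j := by exact_mod_cast hMa j h0
      have h2 : (s : ℤ) + 1 ≤ t := by exact_mod_cast hs
      have h3 : (t : ℤ) * (2 * a₁ j + a₂ j + 1) ≤ t * (M * wX j) :=
        mul_le_mul_of_nonneg_left h1 (by positivity)
      have h4 : (s : ℤ) * a₁ j ≤ t * a₁ j := mul_le_mul_of_nonneg_right (by omega) (by positivity)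
      have h5 : (1 : ℤ) * a₁ j ≤ t * a₁ j := mul_le_mul_of_nonneg_right (by omega) (by positivity)
      have h6 : (0 : ℤ) ≤ s * a₂ j := by positivity
      have h7 : (0 : ℤ) ≤ t * a₂ j := by positivity
      have h8 : (0 : ℤ) ≤ (r : ℤ) * wX j := by positivity
      nlinarith [Int.natCast_nonneg (X j), Int.natCast_nonneg t]
  -- Seen from `X + r • wX`, each round contributes at least one to every counter after pumping up.
  -- Hence `t ≥ L * K` rounds suffice for a walk of length `L` whose steps require at most `K`. The
  -- same holds backwards from the target by `hD`.
  have hP : ∀ j, 1 ≤ (M : ℤ) * wX j + (a₂ j - a₁ j) := fun j => by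
    by_cases h0 : wX j = 0
    · obtain ⟨h1, h2⟩ := ha j h0
      rw [h0, h1]
      push_cast
      omega
    · have h1 : (2 * a₁ j + a₂ j + 1 : ℤ) ≤ M * wX j := by exact_mod_cast hMa j h0
      omega
  have hD : ∀ j, 1 ≤ (M : ℤ) * wY j - (b₂ j - b₁ j) := fun j => by
    by_cases h0 : wY j = 0
    · obtain ⟨h1, h2⟩ := hb j h0
      rw [h0, h1]
      push_cast
      omega
    · have h1 : (2 * b₁ j + b₂ j + 1 : ℤ) ≤ M * wY j := by exact_mod_cast hMb j h0
      omega
  have hz₁' : ∀ j, (z₁ j : ℤ) = X j + r * wX j + t * (M * wX j + (a₂ j - a₁ j)) := fun j => by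
    rw [hz₁]
    simp only [Pi.add_apply, Pi.smul_apply, smul_eq_mul, hm]
    push_cast
    ring
  -- the path
  have hflow₂ : netFlow (V.src i) (V.tgt i) (fun e => ((ux e + r * uw e : ℕ) : ℤ)) =
      Pi.single (V.qfin i) 1 - Pi.single (V.qin i) 1 := by
    have : (fun e => ((ux e + r * uw e : ℕ) : ℤ)) =
        (fun e => (ux e : ℤ)) + (r : ℤ) • fun e => (uw e : ℤ) := by
      ext e; simp
    rw [this, netFlow_add, netFlow_smul, hw_flow, hx_flow, smul_zero, add_zero]
  obtain ⟨z₂, hrun₂⟩ := of_euler (x := z₁) (fun e => ux e + r * uw e)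
    (fun e p => vx e p + r * vw e p)
    (fun e => le_add_left (Nat.mul_pos hr (huw e))) hflow₂ hbase hpath hK₂ hL₂ fun j => by
      have h1 := hz₁' j
      have h2 : (t : ℤ) * 1 ≤ t * (M * wX j + (a₂ j - a₁ j)) :=
        mul_le_mul_of_nonneg_left (hP j) (by positivity)
      have h3 : (0 : ℤ) ≤ (r : ℤ) * wX j := by positivity
      refine ht.trans ?_
      zify
      linarith [Int.natCast_nonneg (X j)]
  have heff₂ : ∀ j, V.totalEffect i (fun e => ((ux e + r * uw e : ℕ) : ℤ))
      (fun e p => ((vx e p + r * vw e p : ℕ) : ℤ)) j = (Y j - X j) + r * (wY j - wX j) := fun j => by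
    have : V.totalEffect i (fun e => ((ux e + r * uw e : ℕ) : ℤ))
        (fun e p => ((vx e p + r * vw e p : ℕ) : ℤ)) =
        V.totalEffect i (fun e => ux e) (fun e p => vx e p) +
          (r : ℤ) • V.totalEffect i (fun e => uw e) (fun e p => vw e p) := by
      rw [← totalEffect_smul, ← totalEffect_add]
      exact totalEffect_congr (fun e => by simp) fun e p _ => by simp
    rw [this, hx_eff, hw_eff]
    simp
  have hz₂ : ∀ j, (z₂ j : ℤ) = Y j + r * wY j + t * (M * wX j + (a₂ j - a₁ j)) := fun j => by
    rw [hrun₂.effect_apply, heff₂, hz₁']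
    ring
  -- the cycle
  have hflow₃ : netFlow (V.src i) (V.tgt i) (fun e => ((M * uw e - u₁ e - u₂ e : ℕ) : ℤ)) =
      Pi.single (V.qfin i) 1 - Pi.single (V.qfin i) 1 := by
    have : (fun e => ((M * uw e - u₁ e - u₂ e : ℕ) : ℤ)) =
        (M : ℤ) • (fun e => (uw e : ℤ)) - (fun e => (u₁ e : ℤ)) - fun e => (u₂ e : ℤ) := by
      ext e
      have : (u₁ e + u₂ e + 1 : ℤ) ≤ M * uw e := by exact_mod_cast hMu e
      simp only [Pi.sub_apply, Pi.smul_apply, smul_eq_mul]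
      have h := hMu e
      rw [Nat.cast_sub (by omega), Nat.cast_sub (by omega)]
      simp
    rw [this, netFlow_sub, netFlow_sub, netFlow_smul, hw_flow, hup.netFlow_eq, hdown.netFlow_eq]
    simp
  -- The cycle is built at the constant configuration `L * K`; only its effect matters when it is
  -- repeated from `z₂`.
  obtain ⟨c, hcyc⟩ := of_euler (x := fun _ => L * K) (fun e => M * uw e - u₁ e - u₂ e)
    (fun e p => M * vw e p - v₁ e p - v₂ e p) (fun e => by have := hMu e; omega) hflow₃ hbase
    hcycle hK₁ hL₁ fun _ => le_rfl
  have heff₃ : ∀ j, (c j : ℤ) - ((L * K : ℕ) : ℤ) =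
      M * (wY j - wX j) - (a₂ j - a₁ j) - (b₂ j - b₁ j) := fun j => by
    have h : V.totalEffect i (fun e => ((M * uw e - u₁ e - u₂ e : ℕ) : ℤ))
        (fun e p => ((M * vw e p - v₁ e p - v₂ e p : ℕ) : ℤ)) +
          V.totalEffect i (fun e => u₁ e) (fun e p => v₁ e p) +
          V.totalEffect i (fun e => u₂ e) (fun e p => v₂ e p) =
        (M : ℤ) • V.totalEffect i (fun e => uw e) (fun e p => vw e p) := by
      rw [← totalEffect_smul, ← totalEffect_add, ← totalEffect_add]
      refine totalEffect_congr (fun e => ?_) fun e p hp => ?_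
      · have := hMu e
        simp only [Pi.add_apply, Pi.smul_apply, smul_eq_mul]
        rw [Nat.cast_sub (by omega), Nat.cast_sub (by omega)]
        push_cast
        ring
      · have := hMv e p hp
        simp only [Pi.add_apply, Pi.smul_apply, smul_eq_mul]
        rw [Nat.cast_sub (by omega), Nat.cast_sub (by omega)]
        push_cast
        ring
    have h1 := hcyc.effect_apply j
    have h2 := hup.effect_apply j
    have h3 := hdown.effect_apply j
    have h4 := hw_eff j
    have h5 := congrFun h j
    simp only [Pi.add_apply, Pi.smul_apply, smul_eq_mul] at h5
    rw [← h4] at h5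
    linarith
  -- Before repetition `s` the `t`-dependent part of a counter is `t - s` times the gain in `hP`
  -- plus `s` times the gain in `hD`. Both gains are at least one, so it is at least `t ≥ L * K`.
  obtain ⟨z₃, hrun₃, hz₃⟩ := hcyc.iterate (x' := z₂) t fun s hs j => by
    rw [heff₃, hz₂]
    have h2 : ((L * K : ℕ) : ℤ) ≤ t := by exact_mod_cast ht
    have h3 : (0 : ℤ) ≤ r * wY j := by positivity
    have h4 : ((t : ℤ) - s) * 1 ≤ (t - s) * (M * wX j + (a₂ j - a₁ j)) :=
      mul_le_mul_of_nonneg_left (hP j) (by omega)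
    have h5 : (s : ℤ) * 1 ≤ s * (M * wY j - (b₂ j - b₁ j)) :=
      mul_le_mul_of_nonneg_left (hD j) (by positivity)
    nlinarith [Int.natCast_nonneg (Y j)]
  have hz₃' : ∀ j, (z₃ j : ℤ) = Y j + r * wY j + t * (M * wY j - (b₂ j - b₁ j)) := fun j => by
    rw [hz₃, heff₃, hz₂]
    ring
  -- pumping down
  obtain ⟨z₄, hrun₄, hz₄⟩ := hdown.iterate (x' := z₃) t fun s hs j => by
    rw [hz₃']
    have h2 : (1 : ℤ) ≤ t - s := by omega
    by_cases h0 : wY j = 0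
    · obtain ⟨h3, h4⟩ := hb j h0
      rw [h0, ← h3]
      have h5 : (1 : ℤ) * (b₁ j - b₂ j) ≤ (t - s) * (b₁ j - b₂ j) :=
        mul_le_mul_of_nonneg_right h2 (by omega)
      push_cast
      nlinarith
    · have h1 : (2 * b₁ j + b₂ j + 1 : ℤ) ≤ M * wY j := by exact_mod_cast hMb j h0
      have h3 : (t : ℤ) * (2 * b₁ j + b₂ j + 1) ≤ t * (M * wY j) :=
        mul_le_mul_of_nonneg_left h1 (by positivity)
      have h4 : (s : ℤ) * b₁ j ≤ t * b₁ j := mul_le_mul_of_nonneg_right (by omega) (by positivity)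
      have h5 : (1 : ℤ) * b₁ j ≤ t * b₁ j := mul_le_mul_of_nonneg_right (by omega) (by positivity)
      have h6 : (0 : ℤ) ≤ s * b₂ j := by positivity
      have h7 : (0 : ℤ) ≤ t * b₂ j := by positivity
      have h8 : (0 : ℤ) ≤ (r : ℤ) * wY j := by positivity
      nlinarith [Int.natCast_nonneg (Y j), Int.natCast_nonneg t]
  have hend : z₄ = Y + m • wY := by
    ext j
    zify
    rw [hz₄, hz₃']
    simp only [Pi.add_apply, Pi.smul_apply, smul_eq_mul, hm]
    push_cast
    ring
  have hall := (hrun₁.append hrun₂).append (hrun₃.append hrun₄)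
  rw [hend] at hall
  have hcount : t • u₁ + (fun e => ux e + r * uw e) +
      (t • (fun e => M * uw e - u₁ e - u₂ e) + t • u₂) = ux + m • uw := by
    ext e
    have := hMu e
    simp only [Pi.add_apply, Pi.smul_apply, smul_eq_mul, hm]
    zify
    rw [Nat.cast_sub (by omega), Nat.cast_sub (by omega)]
    push_cast
    ring
  refine ⟨_, hcount ▸ hall, fun e p hp => ?_⟩
  have := hMv e p hp
  simp only [Pi.add_apply, Pi.smul_apply, smul_eq_mul, hm]
  zify
  rw [Nat.cast_sub (by omega), Nat.cast_sub (by omega)]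
  push_cast
  ring

end MEVASS

/-! ### Short covering runs inside a component -/

theorem IsTruncation.mono {ι κ : Type} {B D D' : ℕ} {z z' : (ι → ℕ) × (κ → ℕ)}
    (h : IsTruncation B D z z') (hD : D ≤ D') : IsTruncation B D' z z' :=
  ⟨fun j => ⟨(h.1 j).1, (h.1 j).2.1, (h.1 j).2.2.trans hD⟩,
    fun j => ⟨(h.2 j).1, (h.2 j).2.1, (h.2 j).2.2.trans hD⟩⟩

theorem exists_cov_of_reflTransGen {Q ι : Type} [Fintype ι]
    {T : Q → (ι → ℕ) → Q → (ι → ℕ) → Prop} {J : Finset ι} {q : Q} {t y : ι → ℕ}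
    {s : Q × (ι → ℕ)}
    (h : Relation.ReflTransGen (fun s s' : Q × (ι → ℕ) => T s.1 s.2 s'.1 s'.2) s (q, y))
    (ht : ∀ j ∈ J, t j ≤ y j) : ∃ M ℓ, Cov T J q t M ℓ s.1 s.2 := by
  induction h using Relation.ReflTransGen.head_induction_on with
  | refl => exact ⟨0, 0, .done ht⟩
  | @head s s' h _ ih =>
    obtain ⟨M, ℓ, ih⟩ := ih
    refine ⟨M + ∑ j, s.2 j + ∑ j, s'.2 j, ℓ + 1, .step (a' := s'.2) h (fun j => ?_) (fun j => ?_)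
      (fun _ _ => le_rfl) (fun j _ => add_comm _ _) (ih.mono (by omega) le_rfl)⟩
    · have := Finset.single_le_sum (f := s.2) (fun _ _ => Nat.zero_le _) (Finset.mem_univ j)
      omega
    · have := Finset.single_le_sum (f := s'.2) (fun _ _ => Nat.zero_le _) (Finset.mem_univ j)
      omega

namespace MEVASS

variable {C : RelClass} (V : MEVASS C) (i : Fin (V.k + 1))

/-- The steps of the `i`-th component. -/
def fwd (p : V.State i) (x : Vec (V.n i)) (q : V.State i) (y : Vec (V.n i)) : Prop :=
  V.Step i (p, x) (q, y)

/-- The reversed steps of the `i`-th component. -/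
def bwd (p : V.State i) (x : Vec (V.n i)) (q : V.State i) (y : Vec (V.n i)) : Prop :=
  V.Step i (q, y) (p, x)

variable {V i}

theorem hasTruncations_fwd {D : ℕ → ℕ}
    (hD : ∀ e, ∀ z ∈ (V.label i e).set, ∀ B, ∃ z' ∈ (V.label i e).set, IsTruncation B (D B) z z') :
    HasTruncations (V.fwd i) D := by
  rintro p x q y ⟨e, h1, h2, h3⟩ B
  obtain ⟨z', hz', h⟩ := hD e _ h3 B
  exact ⟨z', ⟨e, h1, h2, hz'⟩, h⟩

theorem hasTruncations_bwd {D : ℕ → ℕ}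
    (hD : ∀ e, ∀ z ∈ (V.label i e).set, ∀ B, ∃ z' ∈ (V.label i e).set, IsTruncation B (D B) z z') :
    HasTruncations (V.bwd i) D := by
  rintro p x q y ⟨e, h1, h2, h3⟩ B
  obtain ⟨z', hz', h⟩ := hD e _ h3 B
  exact ⟨z'.swap, ⟨e, h1, h2, hz'⟩, h.2, h.1⟩

section

variable (hsub : ∀ e, (V.label i e).set ⊆ hybrid {V.base i e} (V.periods i e))
include hsub

/-- A non-zero period adds at least one to some coordinate for every use, so its coefficient is
bounded by the entries of the step. Coefficients of the zero period do not affect the sum and are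
set to 0. -/
theorem HasRun.of_step {p q : V.State i} {x y : Vec (V.n i)} (h : V.Step i (p, x) (q, y)) {M : ℕ}
    (hx : ∀ j, x j ≤ M) (hy : ∀ j, y j ≤ M) :
    ∃ u v, V.HasRun i p x q y u v ∧ (∀ e, u e ≤ 1) ∧ ∀ e p, v e p ≤ M := by
  classical
  obtain ⟨e, rfl, rfl, h⟩ := h
  obtain ⟨b, hb, c, hc⟩ := hsub e h
  obtain rfl := Finset.mem_singleton.1 hb
  let c' : Pair (V.n i) (V.n i) → ℕ := fun p => if p = 0 ∨ p ∉ V.periods i e then 0 else c p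
  have hc' : (x, y) = V.base i e + ∑ p ∈ V.periods i e, c' p • p := by
    rw [hc]
    congr 1
    refine Finset.sum_congr rfl fun p hp => ?_
    by_cases h0 : p = 0 <;> simp [c', h0, hp]
  refine ⟨_, _, .cons e x y 0 c' h (by rw [hc']; exact (add_zero _).symm) (.nil _ _),
    fun e' => ?_, fun e' p => ?_⟩
  · rcases eq_or_ne e' e with rfl | h <;> simp [*]
  · rcases eq_or_ne e' e with rfl | h
    swap
    · simp [h]
    simp only [add_zero, Pi.single_eq_same]
    by_cases h0 : p = 0 ∨ p ∉ V.periods i e'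
    · simp [c', h0]
    have hval : c' p = c p := by simp only [c', h0, if_false]
    push Not at h0
    obtain ⟨hp0, hp⟩ := h0
    have hle : c' p • p ≤ (x, y) := by
      rw [hc']
      exact le_add_left (Finset.single_le_sum (f := fun p => c' p • p) (fun _ _ => zero_le) hp)
    have hex : (∃ j, p.1 j ≠ 0) ∨ ∃ j, p.2 j ≠ 0 := by
      by_contra! hno
      exact hp0 (Prod.ext (funext hno.1) (funext hno.2))
    rcases hex with ⟨j, hj⟩ | ⟨j, hj⟩
    · have h1 : c' p * p.1 j ≤ x j := hle.1 j
      exact (Nat.le_mul_of_pos_right _ (Nat.pos_of_ne_zero hj)).trans (h1.trans (hx j))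
    · have h1 : c' p * p.2 j ≤ y j := hle.2 j
      exact (Nat.le_mul_of_pos_right _ (Nat.pos_of_ne_zero hj)).trans (h1.trans (hy j))

/-- No coordinate is ignored, so the covering relation describes a genuine run: each step is lifted
by monotonicity and adds at most `M` to a counter. -/
theorem HasRun.of_cov_fwd {p q : V.State i} {a t : Vec (V.n i)} {M ℓ : ℕ}
    (h : Cov (V.fwd i) Finset.univ q t M ℓ p a) :
    ∃ z u v, V.HasRun i p a q z u v ∧ (∀ j, t j ≤ z j ∧ z j ≤ a j + ℓ * M) ∧ (∀ e, u e ≤ ℓ) ∧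
      ∀ e p, v e p ≤ ℓ * M := by
  induction h with
  | done h => exact ⟨_, _, _, .nil _ _, fun j => ⟨h j (Finset.mem_univ j), by omega⟩, by simp,
      by simp⟩
  | @step ℓ p p' x y a a' hT hx hy hle heq _ ih =>
    obtain ⟨z, u, v, h, hz, hu, hv⟩ := ih
    obtain ⟨u', v', h', hu', hv'⟩ := HasRun.of_step hsub hT hx hy
    obtain ⟨y', h'', hy'⟩ := h'.of_le (x' := a) fun j => hle j (Finset.mem_univ j)
    obtain rfl : y' = a' := funext fun j => by
      have := hy' j
      have := heq j (Finset.mem_univ j)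
      omega
    refine ⟨z, _, _, h''.append h, fun j => ⟨(hz j).1, ?_⟩, fun e => ?_, fun e p => ?_⟩
    · have := (hz j).2
      have := hy' j
      have := hy j
      rw [add_mul]
      omega
    · have := hu e
      have := hu' e
      simp only [Pi.add_apply]
      omega
    · have := hv e p
      have := hv' e p
      simp only [Pi.add_apply]
      rw [add_mul]
      omega

theorem HasRun.of_cov_bwd {p q : V.State i} {a t : Vec (V.n i)} {M ℓ : ℕ}
    (h : Cov (V.bwd i) Finset.univ q t M ℓ p a) :
    ∃ z u v, V.HasRun i q z p a u v ∧ (∀ j, t j ≤ z j ∧ z j ≤ a j + ℓ * M) ∧ (∀ e, u e ≤ ℓ) ∧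
      ∀ e p, v e p ≤ ℓ * M := by
  induction h with
  | done h => exact ⟨_, _, _, .nil _ _, fun j => ⟨h j (Finset.mem_univ j), by omega⟩, by simp,
      by simp⟩
  | @step ℓ p p' x y a a' hT hx hy hle heq _ ih =>
    obtain ⟨z, u, v, h, hz, hu, hv⟩ := ih
    obtain ⟨u', v', h', hu', hv'⟩ := HasRun.of_step hsub hT hy hx
    have hya : ∀ j, y j ≤ a' j := fun j => by
      have := heq j (Finset.mem_univ j)
      have := hle j (Finset.mem_univ j)
      omega
    obtain ⟨y', h'', hy'⟩ := h'.of_le (x' := a') hya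
    obtain rfl : y' = a := funext fun j => by
      have := hy' j
      have := heq j (Finset.mem_univ j)
      omega
    refine ⟨z, _, _, h.append h'', fun j => ⟨(hz j).1, ?_⟩, fun e => ?_, fun e p => ?_⟩
    · have := (hz j).2
      have := hy' j
      have := hy j
      rw [add_mul]
      omega
    · have := hu e
      have := hu' e
      simp only [Pi.add_apply]
      omega
    · have := hv e p
      have := hv' e p
      simp only [Pi.add_apply]
      rw [add_mul]
      omega

end

/-- Bounds for the runs that pump up (for `V.fwd`) or down (for `V.bwd`). -/
theorem cov_univ_bounded {T : V.State i → Vec (V.n i) → V.State i → Vec (V.n i) → Prop}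
    {h Φ : ℕ → ℕ} {c₀ : ℕ} (h₀ : 0 < c₀) (hW : HasTruncations T h) (hΦ : ∀ c, c ≤ Φ c)
    (h1 : ∀ c, c₀ ≤ c → h (c * c + c₀) + c ≤ Φ c)
    (h2 : ∀ c, c₀ ≤ c → c + V.numStates i * (c * c + c₀) ^ V.n i ≤ Φ c)
    {J : Finset (Fin (V.n i))} {q : V.State i} {X : Vec (V.n i)} (hX : ∀ j, X j + 1 ≤ c₀)
    {y x : Vec (V.n i)} {p : V.State i}
    (hreach : Relation.ReflTransGen (fun s s' : V.State i × Vec (V.n i) => T s.1 s.2 s'.1 s'.2)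
      (p, x) (q, y)) (hx : ∀ j ∈ J, x j = X j) (hy : ∀ j, X j + 1 ≤ y j) {A : ℕ}
    (hA : Φ^[V.n i + 1] c₀ ≤ A) :
    ∃ b : Vec (V.n i), (∀ j ∈ J, b j = X j) ∧ (∀ j, b j ≤ A * A + A) ∧
      Cov T Finset.univ q (fun j => X j + 1) A A p b := by
  have hmono : Monotone fun k => Φ^[k] c₀ := monotone_nat_of_le_succ fun k => by
    simp only [Function.iterate_succ_apply']
    exact hΦ _
  have hcov := (cov_bounded h₀ hW hΦ h1 (by simpa using h2) J (t := fun j => X j + 1)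
    (fun j _ => hX j) (exists_cov_of_reflTransGen hreach fun j _ => hy j))
  have hle : Φ^[J.card + 1] c₀ ≤ A := by
    refine le_trans (hmono (Nat.add_le_add_right ?_ 1)) hA
    simpa using Finset.card_le_univ J
  have hc₀ : c₀ ≤ A := (hmono (Nat.zero_le (V.n i + 1))).trans hA
  -- Coordinates outside `J` start at `A * A + A`: at most `A` steps with entries at most `A` take
  -- away `A * A`, and the remaining `A` covers the target.
  refine ⟨fun j => if j ∈ J then X j else A * A + A, fun j hj => by simp [hj], fun j => ?_,
    (hcov.mono hle hle).lift (c := A) (fun j hj => by simp [hj, hx j hj])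
      (fun j _ hj => by simp [hj]) fun j _ => (hX j).trans hc₀⟩
  have := hX j
  simp only
  split_ifs <;> omega

end MEVASS

/-- A bound for the number of repetitions that lead into a set with an asymptotic
overapproximation, if all parameters are at most `A` and `G` bounds the overapproximation. -/
def approxBound (G : ℕ → ℕ) (A : ℕ) : ℕ :=
  G (A + A * (A + A * (A * A) + 1) + A * (A * (A * A) + 1))

theorem sum_entries_le {β : Type} (P : Finset β) (c f : β → ℕ) {a b d : ℕ} (hP : P.card ≤ a)
    (hc : ∀ p ∈ P, c p ≤ b) (hf : ∀ p ∈ P, f p ≤ d) : ∑ p ∈ P, c p * f p ≤ a * (b * d) :=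
  (Finset.sum_le_card_nsmul _ _ (b * d) fun p hp => Nat.mul_le_mul (hc p hp) (hf p hp)).trans
    (Nat.mul_le_mul_right _ hP)

/-- The overapproximation is applied to the point with coefficients `c` and the direction with
coefficients `ω`, which is a full combination as `ω ≥ 1`. The argument of `G` in `approxBound`
bounds the sizes of both. -/
theorem AsympOverapprox.add_sum_mem {m n : ℕ} {g G : ℕ → ℕ} (hG : Monotone G) (hg : ∀ x, g x ≤ G x)
    {sX A : ℕ} {X : Set (Pair m n)} {b : Pair m n} {P : Finset (Pair m n)}
    (h : AsympOverapprox pairSize g sX X {b} P) (hsX : sX ≤ A) (hmn : m + n ≤ A) (hP : P.card ≤ A)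
    (hb : (∀ j, b.1 j ≤ A) ∧ ∀ j, b.2 j ≤ A)
    (hp : ∀ p ∈ P, (∀ j, p.1 j ≤ A) ∧ ∀ j, p.2 j ≤ A) (c ω : Pair m n → ℕ)
    (hc : ∀ p ∈ P, c p ≤ A) (hω : ∀ p ∈ P, 1 ≤ ω p ∧ ω p ≤ A) {k : ℕ} (hk : approxBound G A ≤ k) :
    b + ∑ p ∈ P, (c p + k * ω p) • p ∈ X := by
  obtain ⟨N, hN, hmem⟩ := h.2 (b + ∑ p ∈ P, c p • p) ⟨b, Finset.mem_singleton_self b, c, rfl⟩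
    (∑ p ∈ P, ω p • p) ⟨ω, fun p hp => (hω p hp).1, rfl⟩
  have hle : N ≤ k := by
    refine hN.trans ((hg _).trans ((hG ?_).trans hk))
    refine add_le_add (add_le_add hsX ?_) ?_
    · refine (pairSize_le _ (A + A * (A * A)) (fun j => ?_) fun j => ?_).trans
        (Nat.mul_le_mul_right _ hmn)
      · simp only [Prod.fst_add, Prod.fst_sum, Pi.add_apply, Finset.sum_apply]
        exact add_le_add (hb.1 j) (sum_entries_le P c _ hP hc fun p h => (hp p h).1 j)
      · simp only [Prod.snd_add, Prod.snd_sum, Pi.add_apply, Finset.sum_apply]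
        exact add_le_add (hb.2 j) (sum_entries_le P c _ hP hc fun p h => (hp p h).2 j)
    · refine (pairSize_le _ (A * (A * A)) (fun j => ?_) fun j => ?_).trans
        (Nat.mul_le_mul_right _ hmn)
      · simp only [Prod.fst_sum, Finset.sum_apply]
        exact sum_entries_le P ω _ hP (fun p h => (hω p h).2) fun p h => (hp p h).1 j
      · simp only [Prod.snd_sum, Finset.sum_apply]
        exact sum_entries_le P ω _ hP (fun p h => (hω p h).2) fun p h => (hp p h).2 j
  have := hmem k hle
  convert this using 1
  simp only [add_smul, Finset.sum_add_distrib, Finset.smul_sum, mul_smul, add_assoc]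

/-! ### Bounds for the data, and the characteristic system in terms of flows and effects -/

namespace MEVASS

variable {C : RelClass} (V : MEVASS C)

/-- The data of `V` are bounded by `A`. -/
structure BoundedBy (A : ℕ) : Prop where
  dim : ∀ i, V.n i + V.n i ≤ A
  edges : ∀ i, V.numEdges i ≤ A
  states : ∀ i, V.numStates i ≤ A
  label : ∀ i e, (V.label i e).size ≤ A
  base : ∀ i e, (∀ j, (V.base i e).1 j ≤ A) ∧ ∀ j, (V.base i e).2 j ≤ A
  card : ∀ i e, (V.periods i e).card ≤ A
  period : ∀ i e, ∀ p ∈ V.periods i e, (∀ j, p.1 j ≤ A) ∧ ∀ j, p.2 j ≤ A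
  bridge_dim : ∀ i : Fin V.k, V.n i.castSucc + V.n i.succ ≤ A
  bridge_label : ∀ i, (V.bridge i).size ≤ A
  bridge_base : ∀ i, (∀ j, (V.bridgeBase i).1 j ≤ A) ∧ ∀ j, (V.bridgeBase i).2 j ≤ A
  bridge_card : ∀ i, (V.bridgePeriods i).card ≤ A
  bridge_period : ∀ i, ∀ p ∈ V.bridgePeriods i, (∀ j, p.1 j ≤ A) ∧ ∀ j, p.2 j ≤ A

variable {V}

theorem BoundedBy.mono {A A' : ℕ} (h : V.BoundedBy A) (hA : A ≤ A') : V.BoundedBy A' where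
  dim i := (h.dim i).trans hA
  edges i := (h.edges i).trans hA
  states i := (h.states i).trans hA
  label i e := (h.label i e).trans hA
  base i e := ⟨fun j => ((h.base i e).1 j).trans hA, fun j => ((h.base i e).2 j).trans hA⟩
  card i e := (h.card i e).trans hA
  period i e p hp :=
    ⟨fun j => ((h.period i e p hp).1 j).trans hA, fun j => ((h.period i e p hp).2 j).trans hA⟩
  bridge_dim i := (h.bridge_dim i).trans hA
  bridge_label i := (h.bridge_label i).trans hA
  bridge_base i :=
    ⟨fun j => ((h.bridge_base i).1 j).trans hA, fun j => ((h.bridge_base i).2 j).trans hA⟩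
  bridge_card i := (h.bridge_card i).trans hA
  bridge_period i p hp := ⟨fun j => ((h.bridge_period i p hp).1 j).trans hA,
    fun j => ((h.bridge_period i p hp).2 j).trans hA⟩

theorem component_size_le (i : Fin (V.k + 1)) : (1 + V.n i + V.numStates i +
    ∑ e : V.Edge i, (1 + (V.label i e).size + pairSize (V.base i e) +
      ∑ p ∈ V.periods i e, (1 + pairSize p))) ≤ V.size := by
  refine le_trans ?_ (Nat.le_add_right _ _)
  exact Finset.single_le_sum (f := fun i => (1 + V.n i + V.numStates i +
    ∑ e : V.Edge i, (1 + (V.label i e).size + pairSize (V.base i e) +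
    ∑ p ∈ V.periods i e, (1 + pairSize p)))) (fun _ _ => Nat.zero_le _) (Finset.mem_univ i)

theorem n_le_size (i : Fin (V.k + 1)) : V.n i ≤ V.size := by
  have := component_size_le i
  omega

/-- The power of two accounts for entries written in binary, the summand `2 * V.size` for sums of
two dimensions. -/
theorem boundedBy_size : V.BoundedBy (2 * V.size + 2 ^ V.size) := by
  have hcomp := component_size_le (V := V)
  have hsum : ∀ i, V.numEdges i ≤ ∑ e : V.Edge i, (1 + (V.label i e).size +
      pairSize (V.base i e) + ∑ p ∈ V.periods i e, (1 + pairSize p)) := fun i => by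
    have := Finset.card_nsmul_le_sum (Finset.univ : Finset (V.Edge i)) (fun e => (1 +
      (V.label i e).size + pairSize (V.base i e) + ∑ p ∈ V.periods i e, (1 + pairSize p))) 1
      fun e _ => by omega
    simpa using this
  have hedge : ∀ i (e : V.Edge i), (1 + (V.label i e).size +
      pairSize (V.base i e) + ∑ p ∈ V.periods i e, (1 + pairSize p)) ≤ V.size := fun i e => by
    have := Finset.single_le_sum (f := fun e : V.Edge i => (1 + (V.label i e).size +
      pairSize (V.base i e) + ∑ p ∈ V.periods i e, (1 + pairSize p))) (fun _ _ => Nat.zero_le _)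
      (Finset.mem_univ e)
    have := hcomp i
    omega
  have hbridge : ∀ i : Fin V.k, (1 + (V.bridge i).size + pairSize (V.bridgeBase i) +
      ∑ p ∈ V.bridgePeriods i, (1 + pairSize p)) ≤ V.size := fun i => by
    refine le_trans ?_ (Nat.le_add_left _ _)
    exact Finset.single_le_sum (f := fun i => (1 + (V.bridge i).size + pairSize (V.bridgeBase i) +
      ∑ p ∈ V.bridgePeriods i, (1 + pairSize p))) (fun _ _ => Nat.zero_le _) (Finset.mem_univ i)
  have hcard : ∀ {m n : ℕ} (P : Finset (Pair m n)), P.card ≤ ∑ p ∈ P, (1 + pairSize p) :=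
    fun P => by
      have := Finset.card_nsmul_le_sum P (fun p => 1 + pairSize p) 1 fun p _ => by omega
      simpa using this
  have hper : ∀ {m n : ℕ} (P : Finset (Pair m n)), ∀ p ∈ P,
      pairSize p ≤ ∑ p ∈ P, (1 + pairSize p) := fun P p hp => by
    have := Finset.single_le_sum (f := fun p => 1 + pairSize p) (fun _ _ => Nat.zero_le _) hp
    omega
  have hentry : ∀ {m n : ℕ} (z : Pair m n), pairSize z ≤ V.size →
      (∀ j, z.1 j ≤ 2 * V.size + 2 ^ V.size) ∧ ∀ j, z.2 j ≤ 2 * V.size + 2 ^ V.size :=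
    fun z hz => by
      have hpow := Nat.pow_le_pow_right (n := 2) (by norm_num) hz
      exact ⟨fun j => by have := fst_lt_two_pow_pairSize z j; omega,
        fun j => by have := snd_lt_two_pow_pairSize z j; omega⟩
  generalize 2 ^ V.size = T at hentry ⊢
  constructor
  · intro i; have := hcomp i; omega
  · intro i; have := hcomp i; have := hsum i; omega
  · intro i; have := hcomp i; omega
  · intro i e; have := hedge i e; omega
  · intro i e; exact hentry _ (by have := hedge i e; omega)
  · intro i e; have := hedge i e; have := hcard (V.periods i e); omega
  · intro i e p hp
    exact hentry _ (by have := hedge i e; have := hper _ p hp; omega)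
  · intro i; have := hcomp i.castSucc; have := hcomp i.succ; omega
  · intro i; have := hbridge i; omega
  · intro i; exact hentry _ (by have := hbridge i; omega)
  · intro i; have := hbridge i; have := hcard (V.bridgePeriods i); omega
  · intro i p hp
    exact hentry _ (by have := hbridge i; have := hper _ p hp; omega)

/-- The number of uses of a period in an assignment. -/
def periodUses (s : V.Assignment) (i : Fin (V.k + 1)) (e : V.Edge i) (p : Pair (V.n i) (V.n i)) :
    ℕ :=
  if h : p ∈ V.periods i e then s (V.periodVar i e ⟨p, h⟩) else 0

/-- The number of uses of a period of a bridge in an assignment. -/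
def bridgeUses (s : V.Assignment) (i : Fin V.k) (p : Pair (V.n i.castSucc) (V.n i.succ)) : ℕ :=
  if h : p ∈ V.bridgePeriods i then s (V.bridgePeriodVar i ⟨p, h⟩) else 0

theorem eulerKirchhoff_iff (s : V.Assignment) (i : Fin (V.k + 1)) :
    V.EulerKirchhoff s i ↔ netFlow (V.src i) (V.tgt i) (fun e => (s (V.edgeVar i e) : ℤ)) =
      Pi.single (V.qfin i) 1 - Pi.single (V.qin i) 1 := by
  rw [funext_iff]
  simp only [EulerKirchhoff, netFlow, Pi.sub_apply, Pi.single_apply]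

theorem effectEquation_iff (s : V.Assignment) (i : Fin (V.k + 1)) :
    V.EffectEquation s i ↔ ∀ j, (V.target s i j : ℤ) - V.source s i j =
      V.totalEffect i (fun e => s (V.edgeVar i e)) (fun e p => periodUses s i e p) j := by
  have : (∑ e : V.Edge i, ((s (V.edgeVar i e) : ℤ) • effect (V.base i e) +
      ∑ p : V.periods i e, (s (V.periodVar i e p) : ℤ) • effect p.1)) =
      V.totalEffect i (fun e => s (V.edgeVar i e)) (fun e p => periodUses s i e p) := by
    refine Finset.sum_congr rfl fun e _ => ?_
    rw [← Finset.sum_coe_sort (V.periods i e) fun p => (periodUses s i e p : ℤ) • effect p]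
    congr 1
    exact Finset.sum_congr rfl fun p _ => by simp [periodUses]
  rw [EffectEquation, this, funext_iff]
  rfl

theorem bridgeEquation_iff (s : V.Assignment) (i : Fin V.k) :
    V.BridgeEquation s i ↔ (V.target s i.castSucc, V.source s i.succ) =
      V.bridgeBase i + ∑ p ∈ V.bridgePeriods i, bridgeUses s i p • p := by
  have : (∑ p : V.bridgePeriods i, s (V.bridgePeriodVar i p) • p.1) =
      ∑ p ∈ V.bridgePeriods i, bridgeUses s i p • p := by
    rw [← Finset.sum_coe_sort (V.bridgePeriods i) fun p => bridgeUses s i p • p]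
    exact Finset.sum_congr rfl fun p _ => by simp [bridgeUses]
  rw [BridgeEquation, this]

theorem periodUses_add_smul (x w : V.Assignment) (m : ℕ) (i : Fin (V.k + 1)) (e : V.Edge i)
    (p : Pair (V.n i) (V.n i)) :
    periodUses (x + m • w) i e p = periodUses x i e p + m * periodUses w i e p := by
  unfold periodUses
  split_ifs <;> simp

theorem bridgeUses_add_smul (x w : V.Assignment) (m : ℕ) (i : Fin V.k)
    (p : Pair (V.n i.castSucc) (V.n i.succ)) :
    bridgeUses (x + m • w) i p = bridgeUses x i p + m * bridgeUses w i p := by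
  unfold bridgeUses
  split_ifs <;> simp

theorem periodUses_le {s : V.Assignment} {A : ℕ} (h : ∀ v, s v ≤ A) (i : Fin (V.k + 1))
    (e : V.Edge i) (p : Pair (V.n i) (V.n i)) : periodUses s i e p ≤ A := by
  unfold periodUses
  split_ifs
  exacts [h _, Nat.zero_le _]

theorem bridgeUses_le {s : V.Assignment} {A : ℕ} (h : ∀ v, s v ≤ A) (i : Fin V.k)
    (p : Pair (V.n i.castSucc) (V.n i.succ)) : bridgeUses s i p ≤ A := by
  unfold bridgeUses
  split_ifs
  exacts [h _, Nat.zero_le _]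

end MEVASS

/-! ### Explicit constants for the pumping argument -/

namespace MEVASS

variable {C : RelClass} {V : MEVASS C}

/-- The largest coefficients that occur in the pumping argument. -/
def gapBound (G : ℕ → ℕ) (A : ℕ) : ℕ := approxBound G (A * (4 * A + 1)) + 1

/-- The number of repetitions of the pumping cycles in one round. -/
def roundBound (G : ℕ → ℕ) (A : ℕ) : ℕ := 4 * A + 1 + gapBound G A

/-- A bound for the numbers of uses of edges and periods in one round. -/
def usesBound (G : ℕ → ℕ) (A : ℕ) : ℕ := A * (1 + gapBound G A + roundBound G A)

/-- A number from which on all multiples of a homogeneous solution can be added. -/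
def pumpBound (G : ℕ → ℕ) (A : ℕ) : ℕ :=
  gapBound G A + roundBound G A *
    (A * usesBound G A * (A + A * (usesBound G A * A)) + 1)

/-- Every large `m` has to be of the form `r + t * M` with `M` fixed, with `r` large enough for the
path to have all its periods but bounded, and with `t` large enough for the walks. -/
theorem exists_hasRun_of_pumpBound_le {g G : ℕ → ℕ} (hG : Monotone G) (hg : ∀ x, g x ≤ G x) {A : ℕ}
    (hV : V.BoundedBy A) {i : Fin (V.k + 1)}
    (hbase : ∀ e, V.base i e ∈ (V.label i e).set)
    (happ : ∀ e, AsympOverapprox pairSize g (V.label i e).size (V.label i e).set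
      {V.base i e} (V.periods i e))
    {X Y wX wY a₁ a₂ b₁ b₂ : Vec (V.n i)} {ux uw u₁ u₂ : V.Edge i → ℕ}
    {vx vw v₁ v₂ : V.Edge i → Pair (V.n i) (V.n i) → ℕ}
    (hx_flow : netFlow (V.src i) (V.tgt i) (fun e => (ux e : ℤ)) =
      Pi.single (V.qfin i) 1 - Pi.single (V.qin i) 1)
    (hx_eff : ∀ j, (Y j : ℤ) - X j = V.totalEffect i (fun e => ux e) (fun e p => vx e p) j)
    (hw_flow : netFlow (V.src i) (V.tgt i) (fun e => (uw e : ℤ)) = 0)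
    (hw_eff : ∀ j, (wY j : ℤ) - wX j = V.totalEffect i (fun e => uw e) (fun e p => vw e p) j)
    (huw : ∀ e, 1 ≤ uw e) (hvw : ∀ e, ∀ p ∈ V.periods i e, 1 ≤ vw e p)
    (hup : V.HasRun i (V.qin i) a₁ (V.qin i) a₂ u₁ v₁)
    (ha : ∀ j, wX j = 0 → a₁ j = X j ∧ X j + 1 ≤ a₂ j)
    (hdown : V.HasRun i (V.qfin i) b₁ (V.qfin i) b₂ u₂ v₂)
    (hb : ∀ j, wY j = 0 → b₂ j = Y j ∧ Y j + 1 ≤ b₁ j)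
    (hux_le : ∀ e, ux e ≤ A) (huw_le : ∀ e, uw e ≤ A) (hvx_le : ∀ e p, vx e p ≤ A)
    (hvw_le : ∀ e p, vw e p ≤ A) (ha_le : ∀ j, a₁ j ≤ A ∧ a₂ j ≤ A)
    (hb_le : ∀ j, b₁ j ≤ A ∧ b₂ j ≤ A) (hu_le : ∀ e, u₁ e ≤ A ∧ u₂ e ≤ A)
    (hv_le : ∀ e p, v₁ e p ≤ A ∧ v₂ e p ≤ A) {m : ℕ} (hm : pumpBound G A ≤ m) :
    ∃ v, V.HasRun i (V.qin i) (X + m • wX) (V.qfin i) (Y + m • wY) (ux + m • uw) v ∧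
      ∀ e, ∀ p ∈ V.periods i e, v e p = vx e p + m * vw e p := by
  have hA1 : A ≤ A * (4 * A + 1) := Nat.le_mul_of_pos_right A (by omega)
  have hV' := hV.mono hA1
  set Γ := gapBound G A with hΓ
  set M := roundBound G A with hM
  set U := usesBound G A with hU
  have hMdef : M = 4 * A + 1 + Γ := rfl
  have hUdef : U = A * (1 + Γ + M) := rfl
  have hΓ1 : approxBound G (A * (4 * A + 1)) ≤ Γ := Nat.le_succ _
  have hΓpos : 1 ≤ Γ := Nat.le_add_left _ _
  have hMpos : 0 < M := by omega
  have hM4 : 4 * A + 1 ≤ M := by omega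
  have hm' : Γ + M * (A * U * (A + A * (U * A)) + 1) ≤ m := hm
  -- Division of `m - Γ` by `M`: then `Γ ≤ r < Γ + M`, so `U` bounds the uses on the path
  -- independently of `m`, and `t` absorbs the rest.
  set r := Γ + (m - Γ) % M with hr
  set t := (m - Γ) / M with ht
  have hmod := Nat.mod_lt (m - Γ) hMpos
  have hdiv := Nat.mod_add_div (m - Γ) M
  have hmrt : m = r + t * M := by
    have : Γ ≤ m := (Nat.le_add_right _ _).trans hm'
    rw [hr, ht, mul_comm _ M]
    omega
  have hrU : A + r * A ≤ U := by
    calc A + r * A = A * (1 + r) := by ring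
      _ ≤ U := Nat.mul_le_mul_left A (by omega)
  have hMU : M * A ≤ U := by
    rw [hUdef, mul_comm]
    exact Nat.mul_le_mul_left A (by omega)
  -- `4 * A + 1` dominates quantities such as `2 * a₁ j + a₂ j + 1` that a single multiple `M * w`
  -- with `w ≥ 1` must exceed.
  have hle_mul : ∀ {a w : ℕ}, a ≤ 4 * A + 1 → 1 ≤ w → a ≤ M * w := fun ha hw =>
    (ha.trans hM4).trans (Nat.le_mul_of_pos_right M hw)
  have hpoint : ∀ e (c : Pair (V.n i) (V.n i) → ℕ), (∀ p ∈ V.periods i e, c p ≤ U) →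
      ∀ j, (V.point i e c).1 j ≤ A + A * (U * A) := fun e c hc j => by
    simp only [point, Prod.fst_add, Prod.fst_sum, Pi.add_apply, Finset.sum_apply]
    exact add_le_add ((hV.base i e).1 j)
      (sum_entries_le _ c _ (hV.card i e) hc fun p hp => (hV.period i e p hp).1 j)
  have hsum : ∀ f : V.Edge i → ℕ, (∀ e, f e ≤ U) → ∑ e, f e ≤ A * U := fun f hf => by
    refine (Finset.sum_le_card_nsmul _ _ U fun e _ => hf e).trans ?_
    simpa using Nat.mul_le_mul_right U (hV.edges i)
  have hmem : ∀ e (c : Pair (V.n i) (V.n i) → ℕ) k, (∀ p ∈ V.periods i e, c p ≤ A * (4 * A + 1)) →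
      Γ ≤ k → V.point i e (fun p => c p + k * vw e p) ∈ (V.label i e).set := fun e c k hc hk =>
    (happ e).add_sum_mem hG hg (hV'.label i e) (hV'.dim i) (hV'.card i e) (hV'.base i e)
      (hV'.period i e) c (vw e) hc (fun p hp => ⟨hvw e p hp, (hvw_le e p).trans hA1⟩)
      (hΓ1.trans hk)
  have hpump := exists_hasRun_add_mul hbase hx_flow hx_eff hw_flow hw_eff huw hup ha hdown hb
    (M := M) (r := r) (t := t) (K := A + A * (U * A)) (L := A * U)
    (fun e => hle_mul (by have := hu_le e; omega) (huw e))
    (fun e p hp => hle_mul (by have := hv_le e p; omega) (hvw e p hp))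
    (fun j hj => hle_mul (by have := ha_le j; omega) (Nat.pos_of_ne_zero hj))
    (fun j hj => hle_mul (by have := hb_le j; omega) (Nat.pos_of_ne_zero hj))
    (fun e => ?_) (fun e => hmem e _ r (fun p _ => (hvx_le e p).trans hA1) (Nat.le_add_right _ _))
    (hΓpos.trans (Nat.le_add_right _ _))
    (fun e => hpoint e _ fun p _ => ?_) (fun e => hpoint e _ fun p _ => ?_)
    (hsum _ fun e => ?_) (hsum _ fun e => ?_) ?_
  · rw [hmrt]
    exact hpump
  -- Split `M = (4 * A + 1) + Γ`: the first part pays for the uses of the two loops, and the second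
  -- supplies the repetitions that bring the point into the relation.
  · have h := hmem e (fun p => (4 * A + 1) * vw e p - v₁ e p - v₂ e p) Γ
      (fun p _ => (Nat.sub_le _ _).trans ((Nat.sub_le _ _).trans
        ((Nat.mul_le_mul_left _ (hvw_le e p)).trans_eq (mul_comm _ _)))) le_rfl
    convert h using 1
    simp only [point]
    congr 1
    refine Finset.sum_congr rfl fun p hp => ?_
    congr 1
    have h1 := hv_le e p
    have h2 : 4 * A + 1 ≤ (4 * A + 1) * vw e p := Nat.le_mul_of_pos_right _ (hvw e p hp)
    rw [hMdef, add_mul _ Γ]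
    omega
  · exact (Nat.sub_le _ _).trans ((Nat.sub_le _ _).trans
      ((Nat.mul_le_mul_left M (hvw_le e p)).trans hMU))
  · exact (add_le_add (hvx_le e p) (Nat.mul_le_mul_left r (hvw_le e p))).trans hrU
  · exact (Nat.sub_le _ _).trans ((Nat.sub_le _ _).trans
      ((Nat.mul_le_mul_left M (huw_le e)).trans hMU))
  · exact (add_le_add (hux_le e) (Nat.mul_le_mul_left r (huw_le e))).trans hrU
  · rw [ht, Nat.le_div_iff_mul_le hMpos, mul_comm]
    rw [mul_add] at hm'
    omega

end MEVASS

/-! ### Hybridlinearity of solution sets -/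

/-- Dickson's lemma: the minimal elements form an antichain in a well-quasi-order. -/
theorem finite_minimal {ι : Type} [Finite ι] (S : Set (ι → ℕ)) :
    {x | Minimal (· ∈ S) x}.Finite :=
  (setOfPred_minimal_antichain _).finite_of_partiallyWellOrderedOn
    ((Set.isPWO_of_wellQuasiOrderedLE _))

theorem exists_minimal_le {ι : Type} [Finite ι] {S : Set (ι → ℕ)} {x : ι → ℕ} (hx : x ∈ S) :
    ∃ b ≤ x, Minimal (· ∈ S) b :=
  exists_minimal_le_of_wellFoundedLT _ x hx

/-- Sets of vectors that are closed under adding differences of comparable elements are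
hybridlinear. -/
theorem exists_eq_hybrid {ι : Type} [Finite ι] (S : Set (ι → ℕ))
    (hS : ∀ s ∈ S, ∀ h, s + h ∈ S → ∀ s' ∈ S, s' + h ∈ S) :
    ∃ B F : Finset (ι → ℕ), S = hybrid B F := by
  rcases S.eq_empty_or_nonempty with rfl | ⟨s₀, hs₀⟩
  · exact ⟨∅, ∅, by ext; simp [hybrid]⟩
  -- The bases are the minimal elements of `S`, the periods the minimal non-zero vectors whose
  -- addition preserves `S`.
  let H : Set (ι → ℕ) := {h | h ≠ 0 ∧ ∀ s ∈ S, s + h ∈ S}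
  let B := (finite_minimal S).toFinset
  let F := (finite_minimal H).toFinset
  refine ⟨B, F, Set.Subset.antisymm (fun s hs => ?_) ?_⟩
  · obtain ⟨b, hbs, hb⟩ := exists_minimal_le hs
    obtain ⟨h, rfl⟩ := exists_add_of_le hbs
    have hbB : b ∈ B := by simpa [B] using hb
    have hh : ∀ s ∈ S, s + h ∈ S := hS b hb.1 h hs
    clear hbs hs
    have key : b + h ∈ hybrid B F := by
      induction h using WellFoundedLT.induction with
      | ind h ih =>
      by_cases h0 : h = 0
      · subst h0
        simpa using mem_hybrid_of_mem hbB
      obtain ⟨f, hfh, hf⟩ := exists_minimal_le (S := H) (x := h) ⟨h0, hh⟩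
      obtain ⟨h', rfl⟩ := exists_add_of_le hfh
      have hlt : h' < f + h' := by
        refine lt_of_le_of_ne (le_add_of_nonneg_left zero_le) fun heq => hf.1.1 ?_
        exact add_eq_right.1 heq.symm
      -- After splitting off a minimal period `f`, the rest `h'` still preserves `S`, since it is
      -- the difference of the members `s₀ + h` and `s₀ + f`.
      have h1 := ih h' hlt (hS (s₀ + f) (hf.1.2 s₀ hs₀) h' (by
        rw [add_assoc]; exact hh s₀ hs₀))
      have hfF : f ∈ F := by simpa [F] using hf
      have h2 := hybrid_add_nsmul h1 hfF 1
      rwa [one_smul, add_assoc, add_comm h' f] at h2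
    exact key
  · rintro _ ⟨b, hb, c, rfl⟩
    have hbS : b ∈ S := (show Minimal (· ∈ S) b by simpa [B] using hb).1
    have hF : ∀ f ∈ F, ∀ s ∈ S, s + f ∈ S := fun f hf =>
      (show Minimal (· ∈ H) f by simpa [F] using hf).1.2
    clear_value F
    induction F using Finset.cons_induction with
    | empty => simpa using hbS
    | cons f F hf ih =>
      rw [Finset.sum_cons, add_comm (c f • f), ← add_assoc]
      have h1 := ih fun g hg => hF g (Finset.mem_cons_of_mem hg)
      generalize c f = n
      induction n with
      | zero => simpa using h1
      | succ n ihn =>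
        rw [succ_nsmul, ← add_assoc]
        exact hF f (Finset.mem_cons_self f F) _ ihn

/-! ### Homogeneous solutions of the characteristic system -/

namespace MEVASS

variable {C : RelClass} {V : MEVASS C}

/-- Homogeneous solutions of the characteristic system. -/
structure IsHomogeneous (V : MEVASS C) (w : V.Assignment) : Prop where
  flow : ∀ i, netFlow (V.src i) (V.tgt i) (fun e => (w (V.edgeVar i e) : ℤ)) = 0
  effect : ∀ i j, (V.target w i j : ℤ) - V.source w i j =
    V.totalEffect i (fun e => w (V.edgeVar i e)) (fun e p => periodUses w i e p) j
  bridge : ∀ i, (V.target w i.castSucc, V.source w i.succ) =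
    ∑ p ∈ V.bridgePeriods i, bridgeUses w i p • p

theorem netFlow_add_smul (x w : V.Assignment) (m : ℕ) (i : Fin (V.k + 1)) :
    netFlow (V.src i) (V.tgt i) (fun e => ((x + m • w) (V.edgeVar i e) : ℤ)) =
      netFlow (V.src i) (V.tgt i) (fun e => (x (V.edgeVar i e) : ℤ)) +
        (m : ℤ) • netFlow (V.src i) (V.tgt i) (fun e => (w (V.edgeVar i e) : ℤ)) := by
  rw [← netFlow_smul, ← netFlow_add]
  congr 1

theorem totalEffect_add_smul (x w : V.Assignment) (m : ℕ) (i : Fin (V.k + 1)) :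
    V.totalEffect i (fun e => (x + m • w) (V.edgeVar i e))
        (fun e p => periodUses (x + m • w) i e p) =
      V.totalEffect i (fun e => x (V.edgeVar i e)) (fun e p => periodUses x i e p) +
        (m : ℤ) • V.totalEffect i (fun e => w (V.edgeVar i e)) (fun e p => periodUses w i e p) := by
  rw [← totalEffect_smul, ← totalEffect_add]
  exact totalEffect_congr (fun e => by simp) fun e p _ => by
    rw [periodUses_add_smul]; simp

theorem bridge_add_smul (x w : V.Assignment) (m : ℕ) (i : Fin V.k) :
    ∑ p ∈ V.bridgePeriods i, bridgeUses (x + m • w) i p • p =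
      ∑ p ∈ V.bridgePeriods i, bridgeUses x i p • p +
        m • ∑ p ∈ V.bridgePeriods i, bridgeUses w i p • p := by
  rw [Finset.smul_sum, ← Finset.sum_add_distrib]
  exact Finset.sum_congr rfl fun p _ => by rw [bridgeUses_add_smul, add_smul, mul_smul]

theorem mem_sol_iff {s : V.Assignment} : s ∈ V.sol ↔
    (∀ i, netFlow (V.src i) (V.tgt i) (fun e => (s (V.edgeVar i e) : ℤ)) =
      Pi.single (V.qfin i) 1 - Pi.single (V.qin i) 1 ∧
      ∀ j, (V.target s i j : ℤ) - V.source s i j =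
        V.totalEffect i (fun e => s (V.edgeVar i e)) (fun e p => periodUses s i e p) j) ∧
    ∀ i, (V.target s i.castSucc, V.source s i.succ) =
      V.bridgeBase i + ∑ p ∈ V.bridgePeriods i, bridgeUses s i p • p := by
  simp only [← eulerKirchhoff_iff, ← effectEquation_iff, ← bridgeEquation_iff]
  rfl

theorem isHomogeneous_of_add_mem {s w : V.Assignment} (hs : s ∈ V.sol) (hw : s + w ∈ V.sol) :
    V.IsHomogeneous w := by
  rw [← one_smul ℕ w] at hw
  obtain ⟨h1, h2⟩ := mem_sol_iff.1 hs
  obtain ⟨h3, h4⟩ := mem_sol_iff.1 hw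
  refine ⟨fun i => ?_, fun i j => ?_, fun i => ?_⟩
  · have := (h3 i).1
    rw [netFlow_add_smul, (h1 i).1] at this
    simpa using this
  · have h := (h3 i).2 j
    rw [totalEffect_add_smul, Pi.add_apply, ← (h1 i).2 j] at h
    simp only [one_smul, Nat.cast_one, target, source, Pi.add_apply, Nat.cast_add] at h ⊢
    linarith
  · have h := h4 i
    rw [bridge_add_smul, one_smul, ← add_assoc, ← h2 i, one_smul] at h
    exact add_left_cancel (a := (V.target s i.castSucc, V.source s i.succ)) h

theorem IsHomogeneous.add_smul_mem {s w : V.Assignment} (hw : V.IsHomogeneous w) (hs : s ∈ V.sol)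
    (m : ℕ) : s + m • w ∈ V.sol := by
  obtain ⟨h1, h2⟩ := mem_sol_iff.1 hs
  refine mem_sol_iff.2 ⟨fun i => ⟨?_, fun j => ?_⟩, fun i => ?_⟩
  · rw [netFlow_add_smul, (h1 i).1, hw.flow, smul_zero, add_zero]
  · rw [totalEffect_add_smul, Pi.add_apply, ← (h1 i).2 j, Pi.smul_apply, ← hw.effect i j]
    simp only [target, source, Pi.add_apply, Pi.smul_apply, smul_eq_mul]
    push_cast
    ring
  · rw [bridge_add_smul, ← add_assoc, ← h2 i, ← hw.bridge i]
    rfl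

theorem exists_sol_eq_hybrid (V : MEVASS C) : ∃ B F : Finset V.Assignment, V.sol = hybrid B F :=
  exists_eq_hybrid V.sol fun s hs h hsh s' hs' => by
    simpa using (isHomogeneous_of_add_mem hs hsh).add_smul_mem hs' 1

theorem isHomogeneous_of_mem_fullCombinations {B F : Finset V.Assignment} (h : V.sol = hybrid B F)
    {x w : V.Assignment} (hx : x ∈ V.sol) (hw : w ∈ fullCombinations F) : V.IsHomogeneous w := by
  obtain ⟨c, -, rfl⟩ := hw
  refine isHomogeneous_of_add_mem hx ?_
  rw [h] at hx ⊢
  exact hybrid_add_sum hx F (fun f => f) c fun f hf => Or.inr hf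

/-- If a full combination vanishes at `v`, so does every period in `F`, and then the bases alone
bound the values of `v`. -/
theorem Unbounded.one_le {B F : Finset V.Assignment} (h : V.sol = hybrid B F)
    {w : V.Assignment} (hw : w ∈ fullCombinations F) {v : V.Var} (hv : V.Unbounded v) :
    1 ≤ w v := by
  obtain ⟨c, hc, rfl⟩ := hw
  by_contra h0
  have h1 : ∀ f ∈ F, f v = 0 := fun f hf => by
    have h2 := Finset.single_le_sum (f := fun f : V.Assignment => c f * f v)
      (fun _ _ => Nat.zero_le _) hf
    have h3 : ∑ f ∈ F, c f * f v = 0 := by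
      simpa [Finset.sum_apply] using h0
    rw [h3] at h2
    exact (Nat.mul_eq_zero.1 (Nat.le_zero.1 h2)).resolve_left (by have := hc f hf; omega)
  obtain ⟨s, hs, hN⟩ := hv (∑ b ∈ B, b v + 1)
  rw [h] at hs
  obtain ⟨b, hb, c', rfl⟩ := hs
  have h2 : ∑ f ∈ F, c' f * f v = 0 := Finset.sum_eq_zero fun f hf => by rw [h1 f hf, mul_zero]
  have h3 := Finset.single_le_sum (f := fun b : V.Assignment => b v)
    (fun _ _ => Nat.zero_le _) hb
  simp only [Pi.add_apply, Finset.sum_apply, Pi.smul_apply, smul_eq_mul, h2] at hN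
  omega

end MEVASS

/-! ### From perfectness to concrete runs -/

namespace MEVASS

variable {C : RelClass} {V : MEVASS C}

theorem qin_eq_qfin_of_numEdges_eq_zero {i : Fin (V.k + 1)} (h : V.numEdges i = 0) :
    V.qin i = V.qfin i := by
  rcases (V.stronglyConnected i (V.qin i) (V.qfin i)).cases_head with h' | ⟨_, ⟨e, -, -⟩, -⟩
  · exact h'
  · exact absurd e.2 (by omega)

/-- A trivial component has a single state and no effect, so the empty run works. Otherwise covering
`x + 1` at the initial state forwards and at the final state backwards gives the two pumping loops,
shortened by Rackoff's bound. -/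
theorem Perfect.exists_hasRun {g₀ G h Φ : ℕ → ℕ} (hG : Monotone G) (hg : ∀ x, g₀ x ≤ G x)
    (hP : V.Perfect g₀) {B F : Finset V.Assignment} (hsol : V.sol = hybrid B F)
    {x w : V.Assignment} (hx : x ∈ V.sol) (hw : w ∈ fullCombinations F) {c₀ ν : ℕ} (h₀ : 0 < c₀)
    (hV : V.BoundedBy c₀) (hν : ∀ i, V.n i ≤ ν) (hx_le : ∀ v, x v + 1 ≤ c₀) (hw_le : ∀ v, w v ≤ c₀)
    (htr : ∀ i e, ∀ z ∈ (V.label i e).set, ∀ B,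
      ∃ z' ∈ (V.label i e).set, IsTruncation B (h B) z z')
    (hΦ : ∀ c, c ≤ Φ c) (h1 : ∀ c, c₀ ≤ c → h (c * c + c₀) + c ≤ Φ c)
    (h2 : ∀ c, c₀ ≤ c → c + c * (c * c + c₀) ^ c ≤ Φ c) {A : ℕ} (hA : Φ^[ν + 1] c₀ ≤ A)
    (i : Fin (V.k + 1)) {m : ℕ} (hm : pumpBound G (2 * (A * A) + A) ≤ m) :
    ∃ v, V.HasRun i (V.qin i) (V.source (x + m • w) i) (V.qfin i) (V.target (x + m • w) i)
      (fun e => (x + m • w) (V.edgeVar i e)) v ∧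
      ∀ e, ∀ p ∈ V.periods i e, v e p = periodUses (x + m • w) i e p := by
  have hwhom := isHomogeneous_of_mem_fullCombinations hsol hx hw
  rcases Nat.eq_zero_or_pos (V.numEdges i) with h0 | hpos
  · have hempty : IsEmpty (V.Edge i) := by
      change IsEmpty (Fin (V.numEdges i))
      rw [h0]; infer_instance
    have hxy : V.source (x + m • w) i = V.target (x + m • w) i := by
      ext j
      have := ((mem_sol_iff.1 (hwhom.add_smul_mem hx m)).1 i).2 j
      simp only [totalEffect, Finset.univ_eq_empty, Finset.sum_empty, Pi.zero_apply] at this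
      omega
    refine ⟨0, ?_, fun e => hempty.elim e⟩
    rw [hxy, qin_eq_qfin_of_numEdges_eq_zero h0]
    convert HasRun.nil (V.qfin i) (V.target (x + m • w) i) using 1
  · have hmono : Monotone fun k => Φ^[k] c₀ := monotone_nat_of_le_succ fun k => by
      simp only [Function.iterate_succ_apply']
      exact hΦ _
    have hA' : Φ^[V.n i + 1] c₀ ≤ A := (hmono (Nat.add_le_add_right (hν i) 1)).trans hA
    have hc₀A : c₀ ≤ A := (hmono (Nat.zero_le (ν + 1))).trans hA
    have hle : ∀ {a}, a ≤ c₀ → a ≤ 2 * (A * A) + A := fun h => by omega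
    have h2' : ∀ c, c₀ ≤ c → c + V.numStates i * (c * c + c₀) ^ V.n i ≤ Φ c := fun c hc => by
      refine le_trans (Nat.add_le_add_left (Nat.mul_le_mul ((hV.states i).trans hc) ?_) c) (h2 c hc)
      refine Nat.pow_le_pow_right (by omega) (le_trans ?_ hc)
      have := hV.dim i
      omega
    have hsub : ∀ e, (V.label i e).set ⊆ hybrid {V.base i e} (V.periods i e) :=
      fun e => (hP.approx i e).1
    -- the run that pumps up
    obtain ⟨z, hz, ⟨s, hs, hzs⟩, hz2⟩ := hP.forward_cover i hpos (V.qin i) (V.source x i + 1)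
    -- A source variable with `w = 0` is bounded, so by uniqueness the covering run starts there
    -- with the value in `x`. All other coordinates of the start are free.
    obtain ⟨a₁, ha₁, ha₁le, hcov⟩ := cov_univ_bounded (T := V.fwd i)
      (J := Finset.univ.filter fun j => w (V.srcVar i j) = 0) h₀ (hasTruncations_fwd (htr i)) hΦ
      h1 h2' (X := V.source x i) (fun j => hx_le _) hz (fun j hj => by
        rw [hzs]
        refine hP.source_unique i j (fun hu => ?_) s hs x hx
        have := hu.one_le hsol hw
        have := (Finset.mem_filter.1 hj).2
        omega) hz2 hA'
    obtain ⟨a₂, u₁, v₁, hup, ha₂, hu₁, hv₁⟩ := HasRun.of_cov_fwd hsub hcov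
    -- the run that pumps down
    obtain ⟨z, hz, hz2, s, hs, hzs⟩ := hP.backward_cover i hpos (V.qfin i) (V.target x i + 1)
    have hz' : Relation.ReflTransGen (fun s s' : V.State i × Vec (V.n i) => V.bwd i s.1 s.2 s'.1 s'.2)
        (V.qfin i, z.2) (V.qfin i, z.1) :=
      Relation.reflTransGen_swap.2 (show Relation.ReflTransGen (V.Step i) _ _ from hz)
    obtain ⟨b₂, hb₂, hb₂le, hcov⟩ := cov_univ_bounded (T := V.bwd i)
      (J := Finset.univ.filter fun j => w (V.tgtVar i j) = 0) h₀ (hasTruncations_bwd (htr i)) hΦ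
      h1 h2' (X := V.target x i) (fun j => hx_le _) hz' (fun j hj => by
        rw [hzs]
        refine hP.target_unique i j (fun hu => ?_) s hs x hx
        have := hu.one_le hsol hw
        have := (Finset.mem_filter.1 hj).2
        omega) hz2 hA'
    obtain ⟨b₁, u₂, v₂, hdown, hb₁, hu₂, hv₂⟩ := HasRun.of_cov_bwd hsub hcov
    obtain ⟨hxflow, hxeff⟩ := (mem_sol_iff.1 hx).1 i
    -- The loops have an outer end with entries at most `A * A + A`, and their at most `A` steps add
    -- at most `A * A`; this explains `2 * (A * A) + A`.
    obtain ⟨v, hv, hv'⟩ := exists_hasRun_of_pumpBound_le hG hg (A := 2 * (A * A) + A)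
      (hV.mono (hle le_rfl)) (hP.basic i)
      (hP.approx i) hxflow hxeff (hwhom.flow i) (hwhom.effect i)
      (fun e => (hP.edge_unbounded i e).one_le hsol hw)
      (fun e p hp => by
        simpa [periodUses, hp] using (hP.period_unbounded i e ⟨p, hp⟩).one_le hsol hw)
      hup (fun j hj => ⟨ha₁ j (Finset.mem_filter.2 ⟨Finset.mem_univ j, hj⟩), (ha₂ j).1⟩)
      hdown (fun j hj => ⟨hb₂ j (Finset.mem_filter.2 ⟨Finset.mem_univ j, hj⟩), (hb₁ j).1⟩)
      (fun e => hle ((Nat.le_succ _).trans (hx_le _))) (fun e => hle (hw_le _))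
      (periodUses_le (fun v => hle ((Nat.le_succ _).trans (hx_le v))) i)
      (periodUses_le (fun v => hle (hw_le v)) i)
      (fun j => ⟨by have := ha₁le j; omega, by have := ha₁le j; have := (ha₂ j).2; omega⟩)
      (fun j => ⟨by have := hb₂le j; have := (hb₁ j).2; omega, by have := hb₂le j; omega⟩)
      (fun e => ⟨by have := hu₁ e; omega, by have := hu₂ e; omega⟩)
      (fun e p => ⟨by have := hv₁ e p; omega, by have := hv₂ e p; omega⟩) hm
    exact ⟨v, hv, fun e p hp => by rw [hv' e p hp, periodUses_add_smul]⟩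

theorem Perfect.add_smul_mem_concretizable {g₀ G h Φ : ℕ → ℕ} (hG : Monotone G)
    (hg : ∀ x, g₀ x ≤ G x)
    (hP : V.Perfect g₀) {B F : Finset V.Assignment} (hsol : V.sol = hybrid B F)
    {x w : V.Assignment} (hx : x ∈ V.sol) (hw : w ∈ fullCombinations F) {c₀ ν : ℕ} (h₀ : 0 < c₀)
    (hV : V.BoundedBy c₀) (hν : ∀ i, V.n i ≤ ν) (hx_le : ∀ v, x v + 1 ≤ c₀) (hw_le : ∀ v, w v ≤ c₀)
    (htr : ∀ i e, ∀ z ∈ (V.label i e).set, ∀ B,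
      ∃ z' ∈ (V.label i e).set, IsTruncation B (h B) z z')
    (hΦ : ∀ c, c ≤ Φ c) (h1 : ∀ c, c₀ ≤ c → h (c * c + c₀) + c ≤ Φ c)
    (h2 : ∀ c, c₀ ≤ c → c + c * (c * c + c₀) ^ c ≤ Φ c) {A : ℕ} (hA : Φ^[ν + 1] c₀ ≤ A)
    {m : ℕ} (hm : pumpBound G (2 * (A * A) + A) ≤ m) : x + m • w ∈ V.concretizable := by
  have hmem : x + m • w ∈ V.sol :=
    (isHomogeneous_of_mem_fullCombinations hsol hx hw).add_smul_mem hx m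
  have hruns : ∀ i, ∃ r : V.ComponentRun i (V.qin i) (V.source (x + m • w) i) (V.qfin i)
      (V.target (x + m • w) i), (∀ e, r.edgeCount e = (x + m • w) (V.edgeVar i e)) ∧
      ∀ e, ∀ p ∈ V.periods i e, r.periodCount e p = periodUses (x + m • w) i e p := fun i => by
    obtain ⟨v, hv, hv'⟩ := hP.exists_hasRun hG hg hsol hx hw h₀ hV hν hx_le hw_le htr hΦ h1 h2 hA i
      hm
    obtain ⟨r, hr, hr'⟩ := hv.exists_componentRun
    exact ⟨r, hr, fun e p hp => (hr' e p).trans (hv' e p hp)⟩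
  choose r hr hr' using hruns
  have hbridge := (mem_sol_iff.1 hmem).2
  refine ⟨hmem, ⟨fun i => V.source (x + m • w) i, fun i => V.target (x + m • w) i, r,
    fun i => bridgeUses (x + m • w) i, fun i => ?_, hbridge⟩, ?_⟩
  · have hc₀A : c₀ ≤ A := by
      refine le_trans ?_ hA
      exact (monotone_nat_of_le_succ (f := fun k => Φ^[k] c₀) fun k => by
        simp only [Function.iterate_succ_apply']
        exact hΦ _) (Nat.zero_le (ν + 1))
    have hA1 : c₀ ≤ (2 * (A * A) + A) * (4 * (2 * (A * A) + A) + 1) :=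
      (hc₀A.trans (Nat.le_add_left _ _)).trans (Nat.le_mul_of_pos_right _ (by omega))
    have hV' := hV.mono hA1
    rw [hbridge i]
    simp only [bridgeUses_add_smul]
    -- Bridges need no walks: bridge period variables are positive in `w`, and `pumpBound` exceeds
    -- the number of repetitions required by the overapproximation.
    refine (hP.bridge_approx i).add_sum_mem hG hg (hV'.bridge_label i) (hV'.bridge_dim i)
      (hV'.bridge_card i) (hV'.bridge_base i) (hV'.bridge_period i) _ _
      (fun p _ => bridgeUses_le (fun v => ((Nat.le_succ _).trans (hx_le v)).trans hA1) i p)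
      (fun p hp => ⟨?_, bridgeUses_le (fun v => (hw_le v).trans hA1) i p⟩)
      ((Nat.le_succ _).trans ((Nat.le_add_right _ _).trans hm))
    simpa [bridgeUses, hp] using (hP.bridge_unbounded i ⟨p, hp⟩).one_le hsol hw
  · funext v
    rcases v with ⟨i, j⟩ | ⟨i, j⟩ | ⟨i, e⟩ | ⟨i, e, p, hp⟩ | ⟨i, p, hp⟩
    · rfl
    · rfl
    · exact hr i e
    · refine (hr' i e p hp).trans ?_
      simp only [periodUses, hp, dif_pos]
      rfl
    · simp only [Run.sol, bridgeUses, hp, dif_pos]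
      rfl

end MEVASS

theorem Bd.pumpBound {a : ℕ} (ha : 2 ≤ a) {G : ℕ → ℕ} (hG : Bd a G) :
    Bd a (MEVASS.pumpBound G) := by
  have cst := fun c => Bd.const ha c
  have Id : Bd a fun x => x := Bd.id
  have h1 : Bd a (approxBound G) := hG.comp ((Id.add ha (Id.mul ha ((Id.add ha (Id.mul ha
    (Id.mul ha Id))).add ha (cst 1)))).add ha (Id.mul ha ((Id.mul ha (Id.mul ha Id)).add ha
    (cst 1))))
  have h2 : Bd a (MEVASS.gapBound G) :=
    (h1.comp (Id.mul ha (((cst 4).mul ha Id).add ha (cst 1)))).add ha (cst 1)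
  have h3 : Bd a (MEVASS.roundBound G) := (((cst 4).mul ha Id).add ha (cst 1)).add ha h2
  have h4 : Bd a (MEVASS.usesBound G) := Id.mul ha (((cst 1).add ha h2).add ha h3)
  exact h2.add ha (h3.mul ha (((Id.mul ha h4).mul ha (Id.add ha (Id.mul ha (h4.mul ha Id)))).add ha
    (cst 1)))

end EVASS

theorem mainTheorem9 (α : ℕ) (hα : 2 ≤ α) (C : EVASS.RelClass) (hC : C.Approximable α)
    (hI : C.ClosedUnderSemilinearInter α) (g₀ : ℕ → ℕ) (hg₀ : g₀ ∈ EVASS.level α) (d : ℕ) :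
    ∃ g ∈ EVASS.level (α + 2 * d + 2),
      ∀ V : EVASS.MEVASS C, V.dim ≤ d → V.Perfect g₀ →
        (∃ B F : Finset V.Assignment, V.sol = EVASS.hybrid B F) ∧
        ∀ B F : Finset V.Assignment, V.sol = EVASS.hybrid B F →
          EVASS.AsympOverapprox EVASS.vecSize g V.size V.concretizable B F := by
  open EVASS in
  obtain ⟨k, hk⟩ := exists_truncation_bound hα hC hI
  obtain ⟨kg, hkg⟩ := Bd.of_mem_level hα le_rfl hg₀
  have cst := fun c => Bd.const hα c
  have Id : Bd α fun x => x := Bd.id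
  have Sq : Bd α fun x => x * x + x := (Id.mul hα Id).add hα Id
  -- Both requirements on `Φ` are expressed in `c` alone, with `c` in place of `c₀`, so that one `K`
  -- serves all systems; this is enough because only `c ≥ c₀` matters.
  obtain ⟨K, hK⟩ : Bd α fun c => ((fastF α)^[k] (c + (c * c + c)) + c) +
      (c + c * (c * c + c) ^ c) :=
    (((Bd.iterate k).comp (Id.add hα Sq)).add hα Id).add hα
      (Id.add hα (Id.mul hα (Sq.pow hα Id)))
  obtain ⟨k₂, hk₂⟩ : Bd α fun A => MEVASS.pumpBound (fastF α)^[kg] (2 * (A * A) + A) :=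
    (Bd.pumpBound hα (Bd.iterate kg)).comp (((cst 2).mul hα (Id.mul hα Id)).add hα Id)
  obtain ⟨k₃, hk₃⟩ : Bd α fun S => 2 * S + 2 ^ S := ((cst 2).mul hα Id).add hα (Id.two_pow hα)
  obtain ⟨g, hg, hgle⟩ := exists_mem_level_ge_fastF (a := α + 1) (e := α + 2 * d + 1) (by omega)
    (by omega) (k₂ + K + k₃ + 1)
  refine ⟨g, hg, fun V _ hP => ⟨V.exists_sol_eq_hybrid, fun B F hsol =>
    ⟨fun s hs => hsol ▸ hs.1, fun x hx w hw => ⟨_, le_rfl, fun m hm => ?_⟩⟩⟩⟩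
  set S := V.size + vecSize x + vecSize w with hS
  have hc₀ : 2 * V.size + 2 ^ V.size ≤ 2 * S + 2 ^ S := by
    have := Nat.pow_le_pow_right (n := 2) (by norm_num) (show V.size ≤ S by omega)
    omega
  have hpow : ∀ v : V.Var, x v + 1 ≤ 2 * S + 2 ^ S ∧ w v ≤ 2 * S + 2 ^ S := fun v => by
    have h1 := lt_two_pow_vecSize x v
    have h2 := lt_two_pow_vecSize w v
    have h3 := Nat.pow_le_pow_right (n := 2) (by norm_num) (show vecSize x ≤ S by omega)
    have h4 := Nat.pow_le_pow_right (n := 2) (by norm_num) (show vecSize w ≤ S by omega)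
    omega
  have hpos : 0 < 2 * S + 2 ^ S := by positivity
  rw [← hsol] at hx
  -- The bound `2 * S + 2 ^ S` exceeds all data of `V` and all entries of `x` and `w`. It also
  -- replaces the size of each label in the truncation bound, and `S` bounds the number of counters.
  refine hP.add_smul_mem_concretizable (G := (fastF α)^[kg]) (iterate_fastF_mono kg) hkg hsol hx hw
    (h := fun B => (fastF α)^[k] (2 * S + 2 ^ S + B)) (Φ := (fastF α)^[K]) (ν := S) hpos
    (MEVASS.boundedBy_size.mono hc₀) (fun i => (MEVASS.n_le_size i).trans (by omega))
    (fun v => (hpow v).1) (fun v => (hpow v).2) (fun i e z hz B => ?_) (fun c => ?_)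
    (fun c hc => ?_) (fun c hc => ?_) (A := ((fastF α)^[K])^[S + 1] (2 * S + 2 ^ S)) le_rfl ?_
  · obtain ⟨z', hz', h⟩ := hk (V.label i e) z hz B
    exact ⟨z', hz', h.mono (iterate_fastF_mono k (Nat.add_le_add_right
      ((MEVASS.boundedBy_size.mono hc₀).label i e) B))⟩
  · exact (Nat.le_add_right c K).trans (add_le_iterate_fastF hα K c)
  · refine le_trans (le_trans (Nat.add_le_add_right ?_ c) (Nat.le_add_right _ _)) (hK c)
    exact iterate_fastF_mono k (by omega)
  · refine le_trans (le_trans (Nat.add_le_add_left (Nat.mul_le_mul_left c ?_) c)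
      (Nat.le_add_left _ _)) (hK c)
    exact Nat.pow_le_pow_left (by omega) c
  · refine le_trans ((hk₂ _).trans ?_) ((hgle S).trans hm)
    -- In total `F_α` is applied `k₂ + K * (S + 1) + k₃` times to `S`. This number plus `S` is at
    -- most the linear function of `S` used in the choice of `g`.
    rw [← Function.iterate_mul]
    refine (iterate_fastF_mono k₂ (iterate_fastF_mono _ (hk₃ S))).trans ?_
    rw [← Function.iterate_add_apply, ← Function.iterate_add_apply]
    refine (iterate_fastF_le_fastF_succ hα _ S).trans (fastF_mono _ ?_)
    nlinarith [Nat.zero_le (k₂ * S), Nat.zero_le (k₃ * S)]
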